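/- Rings are not assumed to be associative or to have an identity. For a ring $R$ write $(x,y,z)=(xy)z-x(yz)$ for associators and $(x,y)=xy-yx$ for commutators. $R$ is alternative if $(x,y,y)=0=(y,y,x)$ for all $x,y\in R$. Its nucleus is $N=\{n\in R : (n,x,y)=0 \text{ for all } x,y\in R\}$ and its center is $C=\{c\in N : (c,x)=0\text{ for all }x\in R\}$. A non-zero element $r\in R$ is called a zero divisor if there are non-zero $y,y'\in R$ with $ry=0$ and $y'r=0$ (so $r$ is not a zero divisor as soon as it is not a left or not a right zero divisor). **Theorem 1.3.** Let $R$ be an alternative ring that is not associative. Assume that at least one of the following holds: - (H1) no non-zero commutator of $R$ is a zero divisor in $R$; - (H2) no non-zero commutator of $R$ is nilpotent, and no non-zero element of $N$ is a zero divisor in $R$; - (H3) no non-zero commutator of $R$ is nilpotent, $R$ has an identity, and $N$ is a simple ring; and that at least one of the following holds: - (T1) for all $x\in R$, $3x=0$ implies $x=0$; - (T2) every commutative subring of $R$ is associative, and for all $x\in R$, $2x=0$ implies $x=0$. Then: (a) $R$ has no zero divisors: if $x,y\in R$ and $xy=0$, then $x=0$ or $y=0$. (b) If, in addition, the characteristic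 of $R$ is not $2$ (that is, $2x\neq 0$ for some $x\in R$), then $C\neq 0$, and the central quotient $R//C$, the ring of fractions $r/c$ with $r\in R$ and $0\ne c\in C$ (where $r/c=s/d$ if and only if $dr=cs$), is an $8$-dimensional octonion division algebra over its center, and this center is the fraction field $\{c/d : c,d\in C,\ d\neq 0\}$ of $C$. Here an octonion algebra over a field $K$ is an $8$-dimensional unital $K$-algebra with a multiplicative quadratic form whose polar bilinear form is non-degenerate, and it is a division algebra if left and right multiplication by each non-zero element are bijective. -/

import Mathlib

section AlternativeRings

/-- A (not necessarily unital, not necessarily associative) ring is alternative if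
`(x, y, y) = 0 = (y, y, x)` for all `x, y`, where `(x, y, z) = (x y) z - x (y z)`. -/
def IsAlternativeRing (R : Type*) [NonUnitalNonAssocRing R] : Prop :=
  ∀ x y : R, associator x y y = 0 ∧ associator y y x = 0

/-- All associators vanish. -/
def IsAssociativeRing (R : Type*) [NonUnitalNonAssocRing R] : Prop :=
  ∀ x y z : R, associator x y z = 0

/-- `v` is a commutator `x y - y x`. -/
def IsRingCommutator {R : Type*} [NonUnitalNonAssocRing R] (v : R) : Prop :=
  ∃ x y : R, v = x * y - y * x

/-- A non-zero element is a zero divisor if it is both a left and a right zero divisor; thus it is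
*not* a zero divisor as soon as it is not a left or not a right zero divisor. -/
def IsZeroDivisor {R : Type*} [NonUnitalNonAssocRing R] (r : R) : Prop :=
  r ≠ 0 ∧ (∃ y : R, y ≠ 0 ∧ r * y = 0) ∧ (∃ y : R, y ≠ 0 ∧ y * r = 0)

/-- `ringPow v n` is the power `v ^ (n + 1)`, formed by repeated multiplication by `v` on the
right. (Alternative rings are power-associative, so the bracketing is immaterial there.) -/
def ringPow {R : Type*} [NonUnitalNonAssocRing R] (v : R) : ℕ → R
  | 0 => v
  | n + 1 => ringPow v n * v

/-- Some power of `v` with positive exponent is zero. -/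
def IsNilpotentElement {R : Type*} [NonUnitalNonAssocRing R] (v : R) : Prop :=
  ∃ n : ℕ, ringPow v n = 0

/-- The nucleus `N = {n | (n, R, R) = 0}`, which is a subring. -/
def ringNucleus (R : Type*) [NonUnitalNonAssocRing R] : NonUnitalSubring R where
  carrier := {n | ∀ x y : R, associator n x y = 0}
  zero_mem' := by intro x y; simp [associator]
  add_mem' := by
    intro a b ha hb x y
    have h1 := ha x y
    have h2 := hb x y
    simp only [associator, sub_eq_zero] at h1 h2 ⊢
    simp only [add_mul, h1, h2]
  neg_mem' := by
    intro a ha x y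
    have h1 := ha x y
    simp only [associator, sub_eq_zero] at h1 ⊢
    simp only [neg_mul, h1]
  mul_mem' := by
    intro a b ha hb x y
    have ha' : ∀ x y : R, (a * x) * y = a * (x * y) := fun x y => sub_eq_zero.mp (ha x y)
    have hb' : ∀ x y : R, (b * x) * y = b * (x * y) := fun x y => sub_eq_zero.mp (hb x y)
    simp only [associator, sub_eq_zero, ha', hb']

/-- In an alternative ring Mathlib's centre (elements that commute and associate with everything)
is the set of elements of the nucleus that commute with everything. -/
theorem mem_center_iff_mem_ringNucleus {R : Type*} [NonUnitalNonAssocRing R]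
    (hR : IsAlternativeRing R) (c : R) :
    c ∈ NonUnitalSubring.center R ↔ c ∈ ringNucleus R ∧ ∀ x : R, c * x - x * c = 0 := by
  constructor
  · intro h
    exact ⟨fun x y => sub_eq_zero.mpr (h.left_assoc x y).symm,
      fun x => sub_eq_zero.mpr (h.comm x)⟩
  · rintro ⟨hN, hC⟩
    have h1 : ∀ x y : R, (c * x) * y = c * (x * y) := fun x y => sub_eq_zero.mp (hN x y)
    have h2 : ∀ x : R, c * x = x * c := fun x => sub_eq_zero.mp (hC x)
    refine ⟨h2, fun x y => (h1 x y).symm, fun a b => ?_⟩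
    -- the associator is alternating in its last two and in its first two arguments
    have e1 : (a * b) * c + (a * c) * b = a * (b * c) + a * (c * b) := by
      have h := (hR a (b + c)).1
      have hb := (hR a b).1
      have hc := (hR a c).1
      simp only [associator, mul_add, add_mul, sub_eq_zero] at h hb hc
      rw [hb, hc] at h
      have := sub_eq_zero.mpr h
      rw [← sub_eq_zero, ← this]
      abel
    have e2 : (a * c) * b = a * (c * b) := by
      rw [← h2 a, h1]
      have h := (hR b (a + c)).2
      have ha := (hR b a).2
      have hc := (hR b c).2
      simp only [associator, mul_add, add_mul, sub_eq_zero] at h ha hc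
      rw [ha, hc, h1, ← h2 a, h1] at h
      have := sub_eq_zero.mpr h
      rw [← sub_eq_zero, ← this]
      abel
    rw [e2] at e1
    exact add_right_cancel e1

/-- (H1) non-zero commutators are not zero divisors. -/
def HypH1 (R : Type*) [NonUnitalNonAssocRing R] : Prop :=
  ∀ v : R, IsRingCommutator v → v ≠ 0 → ¬ IsZeroDivisor v

/-- (H2) non-zero commutators are not nilpotent, and non-zero elements of the nucleus are not
zero divisors in `R`. -/
def HypH2 (R : Type*) [NonUnitalNonAssocRing R] : Prop :=
  (∀ v : R, IsRingCommutator v → v ≠ 0 → ¬ IsNilpotentElement v) ∧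
    ∀ n ∈ ringNucleus R, n ≠ 0 → ¬ IsZeroDivisor n

/-- (H3) non-zero commutators are not nilpotent, `R` has an identity, and the nucleus is a simple
ring. -/
def HypH3 (R : Type*) [NonUnitalNonAssocRing R] : Prop :=
  (∀ v : R, IsRingCommutator v → v ≠ 0 → ¬ IsNilpotentElement v) ∧
    (∃ e : R, ∀ x : R, e * x = x ∧ x * e = x) ∧
    IsSimpleRing (ringNucleus R)

/-- (T1) no `3`-torsion. -/
def HypT1 (R : Type*) [NonUnitalNonAssocRing R] : Prop :=
  ∀ x : R, 3 • x = 0 → x = 0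

/-- (T2) commutative subrings are associative, and there is no `2`-torsion. -/
def HypT2 (R : Type*) [NonUnitalNonAssocRing R] : Prop :=
  (∀ S : NonUnitalSubring R, (∀ x ∈ S, ∀ y ∈ S, x * y = y * x) →
      ∀ x ∈ S, ∀ y ∈ S, ∀ z ∈ S, associator x y z = 0) ∧
    ∀ x : R, 2 • x = 0 → x = 0

end AlternativeRings

section CentralQuotients

/-- The central quotient of `A` is defined: the centre of `A` is non-zero and its non-zero elements
are not zero divisors in `A`. -/
class HasCentralQuotient (A : Type*) [NonUnitalNonAssocRing A] : Prop where
  exists_ne_zero : ∃ c : NonUnitalSubring.center A, c ≠ 0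
  regular : ∀ c : NonUnitalSubring.center A, c ≠ 0 → ∀ a : A, (c : A) * a = 0 → a = 0

namespace CentralQuotient

variable {A : Type*} [NonUnitalNonAssocRing A]

/-- Multiplication of an element by a central element. -/
def act (c : NonUnitalSubring.center A) (a : A) : A := (c : A) * a

theorem act_mul (c d : NonUnitalSubring.center A) (a : A) : act (c * d) a = act c (act d a) :=
  (c.2.left_assoc (d : A) a).symm

theorem act_comm (c d : NonUnitalSubring.center A) (a : A) :
    act c (act d a) = act d (act c a) := by
  rw [← act_mul, mul_comm, act_mul]

theorem act_mul_left (c : NonUnitalSubring.center A) (a b : A) : act c a * b = act c (a * b) :=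
  (c.2.left_assoc a b).symm

theorem act_mul_right (c : NonUnitalSubring.center A) (a b : A) : a * act c b = act c (a * b) := by
  have h1 : (c : A) * b = b * c := c.2.comm b
  have h2 : (c : A) * (a * b) = (a * b) * c := c.2.comm (a * b)
  simp only [act]
  rw [h1, h2, c.2.right_assoc]

theorem act_add (c : NonUnitalSubring.center A) (a b : A) :
    act c (a + b) = act c a + act c b := mul_add _ _ _

theorem add_act (c d : NonUnitalSubring.center A) (a : A) :
    act (c + d) a = act c a + act d a := add_mul _ _ _

theorem act_neg (c : NonUnitalSubring.center A) (a : A) : act c (-a) = -act c a := mul_neg _ _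

theorem act_zero (c : NonUnitalSubring.center A) : act c (0 : A) = 0 := mul_zero _

theorem coe_mul_eq_act (c : NonUnitalSubring.center A) (a : A) : (c : A) * a = act c a := rfl

theorem mul_coe_eq_act (c : NonUnitalSubring.center A) (a : A) : a * (c : A) = act c a :=
  (c.2.comm a).symm

variable (A) in
/-- The denominators: the non-zero central elements. -/
def Den : Type _ := {c : NonUnitalSubring.center A // c ≠ 0}

variable [HasCentralQuotient A]

theorem act_injective (c : Den A) {a b : A} (h : act c.1 a = act c.1 b) : a = b := by
  rw [← sub_eq_zero]
  apply HasCentralQuotient.regular c.1 c.2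
  rw [mul_sub, sub_eq_zero]
  exact h

instance : Mul (Den A) where
  mul c d := ⟨c.1 * d.1, fun h => d.2 (Subtype.ext
    (HasCentralQuotient.regular c.1 c.2 d.1 (congrArg Subtype.val h)))⟩

theorem den_mul (c d : Den A) : (c * d).1 = c.1 * d.1 := rfl

instance : Nonempty (Den A) :=
  let ⟨c, hc⟩ := HasCentralQuotient.exists_ne_zero (A := A)
  ⟨⟨c, hc⟩⟩

variable (A) in
/-- Pairs `(a, c)` and `(b, d)` represent the same fraction iff `d a = c b`. -/
def fracSetoid : Setoid (A × Den A) where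
  r p q := act q.2.1 p.1 = act p.2.1 q.1
  iseqv :=
    { refl := fun _ => rfl
      symm := fun h => h.symm
      trans := by
        intro p q r h1 h2
        apply act_injective q.2
        rw [act_comm, h1, act_comm, h2, act_comm] }

end CentralQuotient

/-- The central quotient `A // C`: fractions `a / c` with `a ∈ A` and `c` a non-zero element of
the centre `C` of `A`. -/
def CentralQuotient (A : Type*) [NonUnitalNonAssocRing A] [HasCentralQuotient A] : Type _ :=
  Quotient (CentralQuotient.fracSetoid A)

namespace CentralQuotient

section Ring

variable {A : Type*} [NonUnitalNonAssocRing A] [HasCentralQuotient A]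

/-- The fraction `a / c`. -/
def mk (a : A) (c : Den A) : CentralQuotient A := Quotient.mk (fracSetoid A) (a, c)

theorem mk_eq_mk {a b : A} {c d : Den A} : mk a c = mk b d ↔ act d.1 a = act c.1 b :=
  ⟨fun h => Quotient.exact h, fun h => Quotient.sound (s := fracSetoid A) h⟩

theorem ind {p : CentralQuotient A → Prop} (h : ∀ a c, p (mk a c)) (q : CentralQuotient A) : p q :=
  Quotient.inductionOn q fun x => h x.1 x.2

noncomputable instance : Zero (CentralQuotient A) := ⟨mk 0 (Classical.arbitrary (Den A))⟩

noncomputable instance : One (CentralQuotient A) :=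
  ⟨mk ((Classical.arbitrary (Den A)).1 : A) (Classical.arbitrary (Den A))⟩

instance : Neg (CentralQuotient A) where
  neg := Quotient.lift (fun p => mk (-p.1) p.2) (by
    rintro ⟨a, c⟩ ⟨b, d⟩ (h : act d.1 a = act c.1 b)
    rw [mk_eq_mk, act_neg, act_neg, h])

/-- `a / c + b / d = (d a + c b) / (c d)` -/
instance : Add (CentralQuotient A) where
  add := Quotient.lift₂ (fun p q => mk (act q.2.1 p.1 + act p.2.1 q.1) (p.2 * q.2)) (by
    rintro ⟨a, c⟩ ⟨b, d⟩ ⟨a', c'⟩ ⟨b', d'⟩ (h1 : act c'.1 a = act c.1 a')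
      (h2 : act d'.1 b = act d.1 b')
    rw [mk_eq_mk]
    simp only [den_mul, act_mul, act_add]
    congr 1
    · rw [act_comm d'.1 d.1, act_comm c'.1 d.1, act_comm c'.1 d'.1, h1, act_comm d'.1 c.1,
        act_comm d.1 c.1]
    · rw [act_comm d'.1 c.1, h2, act_comm c'.1 c.1, act_comm c'.1 d.1])

/-- `(a / c) (b / d) = (a b) / (c d)` -/
instance : Mul (CentralQuotient A) where
  mul := Quotient.lift₂ (fun p q => mk (p.1 * q.1) (p.2 * q.2)) (by
    rintro ⟨a, c⟩ ⟨b, d⟩ ⟨a', c'⟩ ⟨b', d'⟩ (h1 : act c'.1 a = act c.1 a')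
      (h2 : act d'.1 b = act d.1 b')
    rw [mk_eq_mk]
    simp only [den_mul, act_mul]
    rw [← act_mul_right, ← act_mul_left, h1, h2, act_mul_left, act_mul_right])

theorem zero_def : (0 : CentralQuotient A) = mk 0 (Classical.arbitrary (Den A)) := rfl

theorem one_def : (1 : CentralQuotient A) =
    mk ((Classical.arbitrary (Den A)).1 : A) (Classical.arbitrary (Den A)) := rfl

theorem neg_mk (a : A) (c : Den A) : -mk a c = mk (-a) c := rfl

theorem mk_add_mk (a b : A) (c d : Den A) :
    mk a c + mk b d = mk (act d.1 a + act c.1 b) (c * d) := rfl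

theorem mk_mul_mk (a b : A) (c d : Den A) : mk a c * mk b d = mk (a * b) (c * d) := rfl

noncomputable instance : NonAssocRing (CentralQuotient A) where
  add_assoc x y z := by
    induction x using ind with | _ a c
    induction y using ind with | _ b d
    induction z using ind with | _ e f
    simp only [mk_add_mk, mk_eq_mk, den_mul, act_mul, act_add, act_comm, add_assoc]
  zero_add x := by
    induction x using ind with | _ a c
    simp only [zero_def, mk_add_mk, mk_eq_mk, den_mul, act_mul, act_comm, act_zero, zero_add]
  add_zero x := by
    induction x using ind with | _ a c
    simp only [zero_def, mk_add_mk, mk_eq_mk, den_mul, act_mul, act_zero, add_zero]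
  nsmul := nsmulRec
  zsmul := zsmulRec
  neg_add_cancel x := by
    induction x using ind with | _ a c
    simp only [zero_def, neg_mk, mk_add_mk, mk_eq_mk, den_mul, act_neg, act_zero, neg_add_cancel]
  add_comm x y := by
    induction x using ind with | _ a c
    induction y using ind with | _ b d
    simp only [mk_add_mk, mk_eq_mk, den_mul, act_mul, act_add, act_comm, add_comm]
  left_distrib x y z := by
    induction x using ind with | _ a c
    induction y using ind with | _ b d
    induction z using ind with | _ e f
    simp only [mk_add_mk, mk_mul_mk, mk_eq_mk, den_mul, act_mul, act_add, act_mul_right, mul_add,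
      act_comm]
  right_distrib x y z := by
    induction x using ind with | _ a c
    induction y using ind with | _ b d
    induction z using ind with | _ e f
    simp only [mk_add_mk, mk_mul_mk, mk_eq_mk, den_mul, act_mul, act_add, act_mul_left, add_mul,
      act_comm]
  zero_mul x := by
    induction x using ind with | _ a c
    simp only [zero_def, mk_mul_mk, mk_eq_mk, zero_mul, act_zero]
  mul_zero x := by
    induction x using ind with | _ a c
    simp only [zero_def, mk_mul_mk, mk_eq_mk, mul_zero, act_zero]
  one_mul x := by
    induction x using ind with | _ a c
    simp only [one_def, mk_mul_mk, mk_eq_mk, den_mul, act_mul, coe_mul_eq_act, act_comm]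
  mul_one x := by
    induction x using ind with | _ a c
    simp only [one_def, mk_mul_mk, mk_eq_mk, den_mul, act_mul, mul_coe_eq_act]

end Ring

section CommRing

variable {A : Type*} [NonUnitalCommRing A] [HasCentralQuotient A]

/-- A non-zero element of a commutative associative ring, as a denominator. -/
def toDen (a : A) (h : a ≠ 0) : Den A :=
  ⟨⟨a, by rw [NonUnitalSubring.center_eq_top]; trivial⟩, fun e => h (congrArg Subtype.val e)⟩

theorem mk_eq_zero {a : A} {c : Den A} : mk a c = 0 ↔ a = 0 := by
  rw [zero_def, mk_eq_mk, act_zero]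
  constructor
  · intro h
    exact act_injective _ (h.trans (act_zero _).symm)
  · rintro rfl
    exact act_zero _

open Classical in
/-- `(a / c)⁻¹ = c / a` for `a ≠ 0`, and `0⁻¹ = 0`. -/
noncomputable instance : Inv (CentralQuotient A) where
  inv := Quotient.lift (fun p => if h : p.1 = 0 then 0 else mk (p.2.1 : A) (toDen p.1 h)) (by
    rintro ⟨a, c⟩ ⟨b, d⟩ (h : act d.1 a = act c.1 b)
    have hab : a = 0 ↔ b = 0 := by
      rw [← mk_eq_zero (c := c), mk_eq_mk.mpr h, mk_eq_zero]
    by_cases ha : a = 0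
    · simp only [ha, hab.mp ha, dite_true]
    · have hb : b ≠ 0 := fun hb => ha (hab.mpr hb)
      simp only [ha, hb, dite_false, mk_eq_mk]
      change b * (c.1 : A) = a * (d.1 : A)
      rw [mul_comm b, mul_comm a]
      exact h.symm)

theorem inv_mk {a : A} (h : a ≠ 0) (c : Den A) : (mk a c)⁻¹ = mk (c.1 : A) (toDen a h) :=
  dif_neg h

theorem inv_mk_zero (c : Den A) : (mk (0 : A) c)⁻¹ = 0 := dif_pos rfl

/-- For a commutative associative ring (all of whose elements are central) the fractions form a
field, the field of fractions. -/
noncomputable instance : Field (CentralQuotient A) where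
  __ := (inferInstance : NonAssocRing (CentralQuotient A))
  mul_assoc x y z := by
    induction x using ind with | _ a c
    induction y using ind with | _ b d
    induction z using ind with | _ e f
    simp only [mk_mul_mk, mk_eq_mk, den_mul, act_mul, mul_assoc]
  mul_comm x y := by
    induction x using ind with | _ a c
    induction y using ind with | _ b d
    simp only [mk_mul_mk, mk_eq_mk, den_mul, act_mul, mul_comm]
  exists_pair_ne := by
    refine ⟨1, 0, fun h => ?_⟩
    rw [one_def, mk_eq_zero] at h
    exact (Classical.arbitrary (Den A)).2 (Subtype.ext h)
  mul_inv_cancel x := by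
    induction x using ind with | _ a c
    intro h
    have ha : a ≠ 0 := fun e => h (mk_eq_zero.mpr e)
    rw [inv_mk ha, mk_mul_mk, one_def, mk_eq_mk, den_mul, act_mul]
    change _ * (a * (c.1 : A)) = (c.1 : A) * (a * _)
    ac_rfl
  inv_zero := by
    rw [zero_def, inv_mk_zero, zero_def]
  nnqsmul := _
  qsmul := _
  npow := npowRec

end CommRing

section Scalars

variable {R : Type*} [NonUnitalNonAssocRing R]

instance [HasCentralQuotient R] : HasCentralQuotient (NonUnitalSubring.center R) where
  exists_ne_zero := by
    obtain ⟨c, hc⟩ := HasCentralQuotient.exists_ne_zero (A := R)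
    refine ⟨⟨c, by rw [NonUnitalSubring.center_eq_top]; trivial⟩, fun h => hc ?_⟩
    exact congrArg Subtype.val h
  regular c hc a h := Subtype.ext
    (HasCentralQuotient.regular (c : NonUnitalSubring.center R) (fun e => hc (Subtype.ext e)) a
      (congrArg Subtype.val h))

/-- A non-zero element of the centre `C` of `R` as an element of `R`. -/
def denToDen (d : Den (NonUnitalSubring.center R)) : Den R :=
  ⟨d.1.1, fun e => d.2 (Subtype.ext e)⟩

theorem denToDen_mul [HasCentralQuotient R] (d e : Den (NonUnitalSubring.center R)) :
    denToDen (d * e) = denToDen d * denToDen e := rfl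

theorem denToDen_val (d : Den (NonUnitalSubring.center R)) : (denToDen d).1 = d.1.1 := rfl

theorem act_center (d : NonUnitalSubring.center (NonUnitalSubring.center R))
    (x : NonUnitalSubring.center R) : act d x = d.1 * x := rfl

end Scalars

end CentralQuotient

/-- The fraction field of the centre `C` of `R`: fractions `c / d` with `c, d ∈ C`, `d ≠ 0`. -/
abbrev CenterFractionField (R : Type*) [NonUnitalNonAssocRing R] [HasCentralQuotient R] : Type _ :=
  CentralQuotient (NonUnitalSubring.center R)

namespace CentralQuotient

variable {R : Type*} [NonUnitalNonAssocRing R] [HasCentralQuotient R]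

/-- `(c / d) • (r / e) = (c r) / (d e)` -/
instance : SMul (CenterFractionField R) (CentralQuotient R) where
  smul := Quotient.lift₂ (fun p q => mk (act p.1 q.1) (denToDen p.2 * q.2)) (by
    rintro ⟨x, d⟩ ⟨r, e⟩ ⟨x', d'⟩ ⟨r', e'⟩ (h1 : d'.1.1 * x = d.1.1 * x')
      (h2 : act e'.1 r = act e.1 r')
    rw [mk_eq_mk]
    simp only [den_mul, act_mul, denToDen_val]
    rw [act_comm e'.1 x, h2, ← act_mul, h1, act_mul, act_comm x' e.1])

theorem mk_smul_mk (x : NonUnitalSubring.center R) (d : Den (NonUnitalSubring.center R))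
    (r : R) (e : Den R) :
    (mk x d : CenterFractionField R) • (mk r e : CentralQuotient R) =
      mk (act x r) (denToDen d * e) := rfl

instance : Module (CenterFractionField R) (CentralQuotient R) where
  one_smul a := by
    induction a using ind with | _ r e
    rw [one_def, mk_smul_mk]
    simp only [mk_eq_mk, den_mul, act_mul, denToDen_val, act_comm]
  mul_smul k l a := by
    induction a using ind with | _ r e
    induction k using ind with | _ x d
    induction l using ind with | _ y f
    rw [mk_smul_mk, mk_mul_mk, mk_smul_mk, mk_smul_mk]
    simp only [mk_eq_mk, den_mul, denToDen_mul, act_mul, act_comm]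
  smul_zero k := by
    induction k using ind with | _ x d
    simp only [zero_def (A := R), mk_smul_mk, mk_eq_mk, act_zero]
  smul_add k a b := by
    induction a using ind with | _ r e
    induction b using ind with | _ s f
    induction k using ind with | _ x d
    simp only [mk_add_mk, mk_smul_mk, mk_eq_mk, den_mul, act_mul, act_add, act_comm]
  add_smul k l a := by
    induction a using ind with | _ r e
    induction k using ind with | _ x d
    induction l using ind with | _ y f
    rw [mk_add_mk, mk_smul_mk, mk_smul_mk, mk_smul_mk, mk_add_mk]
    simp only [mk_eq_mk, den_mul, denToDen_mul, act_mul, act_add, add_act, act_center, act_comm,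
      denToDen_val]
  zero_smul a := by
    induction a using ind with | _ r e
    rw [zero_def, mk_smul_mk, zero_def, mk_eq_mk, act_zero]
    change act _ ((0 : R) * r) = 0
    rw [zero_mul, act_zero]

instance : IsScalarTower (CenterFractionField R) (CentralQuotient R) (CentralQuotient R) where
  smul_assoc k a b := by
    induction a using ind with | _ r e
    induction b using ind with | _ s f
    induction k using ind with | _ x d
    simp only [smul_eq_mul, mk_smul_mk, mk_mul_mk, mk_eq_mk, den_mul, act_mul, act_mul_left,
      act_comm]

instance : SMulCommClass (CenterFractionField R) (CentralQuotient R) (CentralQuotient R) where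
  smul_comm k a b := by
    induction a using ind with | _ r e
    induction b using ind with | _ s f
    induction k using ind with | _ x d
    simp only [smul_eq_mul, mk_smul_mk, mk_mul_mk, mk_eq_mk, den_mul, act_mul, act_mul_right,
      act_comm]

end CentralQuotient

end CentralQuotients

section Octonions

/-- An octonion algebra over the field `K`: an `8`-dimensional composition algebra, that is, a
unital (not necessarily associative) `K`-algebra of dimension `8` with a quadratic form that is
multiplicative and whose polar bilinear form is nondegenerate. -/
structure IsOctonionAlgebra (K A : Type*) [Field K] [NonAssocRing A] [Module K A]
    [IsScalarTower K A A] [SMulCommClass K A A] : Prop where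
  finrank_eq : Module.finrank K A = 8
  exists_norm : ∃ N : QuadraticForm K A,
    (∀ x y : A, N (x * y) = N x * N y) ∧
      ∀ x : A, (∀ y : A, QuadraticMap.polar N x y = 0) → x = 0

/-- Left and right division by non-zero elements is possible and unique. -/
def IsDivisionAlgebra (A : Type*) [NonAssocRing A] : Prop :=
  Nontrivial A ∧ ∀ a : A, a ≠ 0 →
    Function.Bijective (fun x : A => a * x) ∧ Function.Bijective (fun x : A => x * a)

end Octonions

/-! Two tools carry the argument. Kleinfeld's function f, which measures the failure of a product
rule for associators, is alternating in its four arguments; and two elements always lie in an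
associative subring (Artin), so computations with two elements may be done as if the ring were
associative.

Let v = [x, y]. Alternation of f shows that v anticommutes with (x, y, z). Hence (v², x, R) = (v²,
y, R) = 0, then v kills (v², R, R) on both sides, and v⁴ lies in N. If v kills r on both sides, so
does v⁴; thus (H2), and (H3) since it implies (H2), give what (H1) says directly: a non-zero
commutator kills no non-zero element on both sides (`CommutatorsRegular`). From there on only this
is used.

The identity [xy, z] - x[y, z] - [x, z]y = 3(x, y, z) brings in (T1) and (T2). R is not commutative,
and a right ideal whose elements commute with everything is zero (`eq_zero_of_mem_commuting_ideal`).
The square-zero elements form such an ideal; once they are gone, so does the annihilator of any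
non-zero element, which is (a).

Without zero divisors, v² itself is in N, and [n, x](x, y, z) = 0 puts N inside C. So squares of
commutators are central, which forces every element of R//C to satisfy a quadratic equation when 2 ≠
0. Half the trace gives a conjugation and an anisotropic multiplicative norm. Cayley–Dickson
doubling from the scalars then produces subalgebras of dimension 1, 2, 4, 8: the first two are
commutative and the third would make the algebra associative if it were everything, so none of them
is everything; the fourth is not associative, and this excludes any element orthogonal to it. -/

namespace IsAlternativeRing

/-! ### Associators and Kleinfeld's function -/

variable {R : Type*} [NonUnitalNonAssocRing R]

theorem associator_add_left (a b y z : R) :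
    associator (a + b) y z = associator a y z + associator b y z := by
  simp only [associator, add_mul]; abel

theorem associator_add_mid (a b y z : R) :
    associator y (a + b) z = associator y a z + associator y b z := by
  simp only [associator, add_mul, mul_add]; abel

theorem associator_add_right (a b y z : R) :
    associator y z (a + b) = associator y z a + associator y z b := by
  simp only [associator, mul_add]; abel

theorem associator_sub_left (a b y z : R) :
    associator (a - b) y z = associator a y z - associator b y z := by
  simp only [associator, sub_mul]; abel

theorem associator_neg_left (a y z : R) : associator (-a) y z = -associator a y z := by
  simp only [associator, neg_mul]; abel

theorem associator_neg_right (a y z : R) : associator y z (-a) = -associator y z a := by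
  simp only [associator, mul_neg]; abel

theorem associator_zero_left (y z : R) : associator 0 y z = 0 := by simp [associator]

theorem associator_zero_mid (y z : R) : associator y 0 z = 0 := by simp [associator]

theorem associator_zero_right (y z : R) : associator y z 0 = 0 := by simp [associator]

/-- The Teichmüller identity. -/
theorem teichmuller (w x y z : R) :
    associator (w * x) y z - associator w (x * y) z + associator w x (y * z) =
      w * associator x y z + associator w x y * z := by
  simp only [associator, mul_sub, sub_mul]; abel

variable (h : IsAlternativeRing R)
include h

theorem swap_left (x y z : R) : associator x y z = -associator y x z := by
  have e := (h z (x + y)).2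
  rw [associator_add_left, associator_add_mid, associator_add_mid, (h z x).2, (h z y).2] at e
  rw [eq_neg_iff_add_eq_zero, ← e]; abel

theorem swap_right (x y z : R) : associator x y z = -associator x z y := by
  have e := (h x (y + z)).1
  rw [associator_add_right, associator_add_mid, associator_add_mid, (h x y).1, (h x z).1] at e
  rw [eq_neg_iff_add_eq_zero, ← e]; abel

theorem cyc (x y z : R) : associator x y z = associator y z x := by
  rw [h.swap_left, h.swap_right, neg_neg]

theorem self_outer (x y : R) : associator x y x = 0 := by
  rw [h.cyc, (h y x).1]

end IsAlternativeRing

/-- Kleinfeld's function `f(w, x, y, z) = (wx, y, z) - x (w, y, z) - (x, y, z) w`. -/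
def kleinfeld {R : Type*} [NonUnitalNonAssocRing R] (w x y z : R) : R :=
  associator (w * x) y z - x * associator w y z - associator x y z * w

namespace IsAlternativeRing

variable {R : Type*} [NonUnitalNonAssocRing R] (h : IsAlternativeRing R)
include h

/-- This is the Teichmüller identity rewritten through f; its right side changes sign under a cyclic
shift of (w, x, y, z). -/
theorem kleinfeld_cyclic_sum (w x y z : R) :
    kleinfeld w x y z - kleinfeld x y z w + kleinfeld y z w x =
      (w * associator x y z - associator x y z * w)
      - (x * associator y z w - associator y z w * x)
      + (y * associator z w x - associator z w x * y)
      - (z * associator w x y - associator w x y * z) := by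
  have t := teichmuller w x y z
  rw [h.cyc w (x * y) z, ← h.cyc (y * z) w x] at t
  simp only [kleinfeld]
  rw [h.cyc w y z, h.cyc x z w, h.cyc y w x]
  linear_combination (norm := abel) t

/-- Two consecutive shifts of the cyclic sum have opposite right sides, and their left sides
telescope to f(x, y, z, w) + f(w, x, y, z). With the evident alternation in the last two arguments
this makes f alternating. -/
theorem kleinfeld_cyc (w x y z : R) : kleinfeld w x y z = -kleinfeld x y z w := by
  have e1 := h.kleinfeld_cyclic_sum x y z w
  have e2 := h.kleinfeld_cyclic_sum y z w x
  linear_combination (norm := abel) e1 + e2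

theorem kleinfeld_swap_right (w x y z : R) : kleinfeld w x y z = -kleinfeld w x z y := by
  simp only [kleinfeld]
  rw [h.swap_right (w * x) y z, h.swap_right w y z, h.swap_right x y z, mul_neg, neg_mul]
  abel

theorem kleinfeld_self_right (w x y : R) : kleinfeld w x y y = 0 := by
  simp only [kleinfeld, (h _ y).1, mul_zero, zero_mul, sub_zero]

theorem kleinfeld_swap_mid (w x y z : R) : kleinfeld w x y z = -kleinfeld w y x z := by
  rw [h.kleinfeld_cyc w x, h.kleinfeld_cyc x, h.kleinfeld_cyc w y x, h.kleinfeld_cyc y x,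
    h.kleinfeld_cyc y z, h.kleinfeld_cyc x z, h.kleinfeld_swap_right z w]

theorem kleinfeld_swap_left (w x y z : R) : kleinfeld w x y z = -kleinfeld x w y z := by
  rw [h.kleinfeld_cyc w x, h.kleinfeld_cyc x y, h.kleinfeld_cyc x w, h.kleinfeld_cyc w y,
    h.kleinfeld_swap_right y z]

theorem kleinfeld_self_mid (w x z : R) : kleinfeld w x x z = 0 := by
  rw [h.kleinfeld_swap_right, h.kleinfeld_swap_mid, h.kleinfeld_self_right, neg_zero, neg_zero]

theorem kleinfeld_self_left (x y z : R) : kleinfeld x x y z = 0 := by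
  rw [h.kleinfeld_cyc, h.kleinfeld_cyc, h.kleinfeld_self_right, neg_zero, neg_zero]

theorem kleinfeld_self_13 (x y z : R) : kleinfeld x y x z = 0 := by
  rw [h.kleinfeld_swap_left, h.kleinfeld_self_mid, neg_zero]

theorem kleinfeld_pair (w x y z : R) : kleinfeld w x y z = kleinfeld y z w x := by
  rw [h.kleinfeld_cyc w x, h.kleinfeld_cyc x y, neg_neg]

theorem mul_self_left (x y z : R) :
    associator (x * x) y z = x * associator x y z + associator x y z * x := by
  have e := h.kleinfeld_self_left x y z
  simp only [kleinfeld] at e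
  linear_combination (norm := abel) e

/-- f vanishes on a repeated argument, and one of its three terms is itself an associator with a
repeated entry. The two bump rules pull a factor out of an associator that already contains it. -/
theorem bump_left (w x z : R) : associator (w * x) x z = x * associator w x z := by
  have e := h.kleinfeld_self_mid w x z
  simp only [kleinfeld, (h z x).2, zero_mul] at e
  linear_combination (norm := abel) e

theorem bump_right (w x z : R) : associator (x * w) x z = associator w x z * x := by
  have e := h.kleinfeld_self_13 x w z
  simp only [kleinfeld, (h z x).2, mul_zero] at e
  linear_combination (norm := abel) e

theorem associator_mul_fst (x y z : R) : associator x y (x * z) = associator x y z * x := by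
  rw [← h.cyc, h.bump_right, h.cyc z]

theorem associator_mul_fst' (x y z : R) : associator x y (z * x) = x * associator x y z := by
  rw [← h.cyc, h.bump_left, h.cyc z]

theorem associator_mul_snd (x y z : R) : associator x y (y * z) = associator x y z * y := by
  rw [h.swap_left, h.associator_mul_fst, h.swap_left x, neg_mul]

/-- The middle Moufang identity. -/
theorem middle_moufang (x y z : R) : (x * y) * (z * x) = x * ((y * z) * x) := by
  have e1 := h.associator_mul_fst' x y z
  rw [h.cyc x y z] at e1
  simp only [associator, mul_sub] at e1
  linear_combination (norm := abel) e1

end IsAlternativeRing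

/-! ### Artin's theorem -/

/-- Right-nested products `a₁ (a₂ (⋯ aₙ))` of length `n` with factors in `{x, y}`. -/
inductive IsTwoWord {R : Type*} [Mul R] (x y : R) : ℕ → R → Prop
  | one (a : R) (ha : a = x ∨ a = y) : IsTwoWord x y 1 a
  | cons (a : R) (ha : a = x ∨ a = y) (n : ℕ) (p : R) (hp : IsTwoWord x y n p) :
      IsTwoWord x y (n + 1) (a * p)

namespace IsAlternativeRing

variable {R : Type*} [NonUnitalNonAssocRing R] (h : IsAlternativeRing R)
include h

theorem associator_mul_eq_zero {a q r : R} (e : associator a q r = 0) :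
    associator a (a * q) r = 0 := by
  rw [h.swap_left, h.bump_right, h.swap_left q, e, neg_zero, zero_mul, neg_zero]

/-- Alternation gives f(a, p, aq, r) = -f(p, r, a, aq). Expanded, every term other than (ap, aq, r)
vanishes by hypothesis. -/
theorem associator_mul_mul_eq_zero {a p q r : R} (e1 : associator a q r = 0)
    (e2 : associator p (a * q) r = 0) (e3 : associator a q p = 0)
    (e4 : associator a q (p * r) = 0) : associator (a * p) (a * q) r = 0 := by
  have k1 : kleinfeld a p (a * q) r = -kleinfeld p r a (a * q) := by
    rw [h.kleinfeld_swap_left, h.kleinfeld_swap_right, h.kleinfeld_swap_mid p r, neg_neg]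
  simp only [kleinfeld, h.cyc _ a (a * q), h.associator_mul_eq_zero e1,
    h.associator_mul_eq_zero e3, h.associator_mul_eq_zero e4, e2, mul_zero, zero_mul, sub_zero,
    neg_zero] at k1
  exact k1

omit h in
theorem isTwoWord_mul {x y : R} {n : ℕ} (ih : ∀ i j k p q r, i + j + k < n → IsTwoWord x y i p →
      IsTwoWord x y j q → IsTwoWord x y k r → associator p q r = 0) {i k : ℕ} {p r : R}
    (hp : IsTwoWord x y i p) (hr : IsTwoWord x y k r) (hn : i + k < n) :
    IsTwoWord x y (i + k) (p * r) := by
  induction hp with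
  | one a ha => rw [add_comm]; exact .cons a ha _ _ hr
  | cons a ha m p hp ih' =>
    have e := ih 1 m k a p r (by omega) (.one a ha) hp hr
    rw [associator, sub_eq_zero] at e
    rw [e, add_right_comm]
    exact .cons a ha _ _ (ih' (by omega))

theorem associator_eq_zero_of_head {x y a : R} {n : ℕ} (ha : a = x ∨ a = y)
    (ih : ∀ i j k p q r, i + j + k < n → IsTwoWord x y i p →
      IsTwoWord x y j q → IsTwoWord x y k r → associator p q r = 0) {i j k : ℕ} {p q r : R}
    (hp : p = a ∨ ∃ i', i' + 1 = i ∧ ∃ p', IsTwoWord x y i' p' ∧ p = a * p')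
    (hq : q = a ∨ ∃ j', j' + 1 = j ∧ ∃ q', IsTwoWord x y j' q' ∧ q = a * q')
    (hi : 0 < i) (hj : 0 < j) (hk : 0 < k)
    (hr : IsTwoWord x y k r) (hn : i + j + k = n) : associator p q r = 0 := by
  have ha' : IsTwoWord x y 1 a := .one a ha
  rcases hp with rfl | ⟨i, rfl, p, hp, rfl⟩ <;> rcases hq with rfl | ⟨j, rfl, q, hq, rfl⟩
  · exact (h r _).2
  · exact h.associator_mul_eq_zero (ih 1 j k _ q r (by omega) ha' hq hr)
  · rw [h.swap_left, h.associator_mul_eq_zero (ih 1 i k _ p r (by omega) ha' hp hr), neg_zero]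
  · refine h.associator_mul_mul_eq_zero (ih 1 j k a q r (by omega) ha' hq hr)
      (ih i (j + 1) k p (a * q) r (by omega) hp (.cons a ha _ _ hq) hr)
      (ih 1 j i a q p (by omega) ha' hq hp) (ih 1 j (i + k) a q (p * r) (by omega) ha' hq
        (isTwoWord_mul ih hp hr (by omega)))

theorem associator_isTwoWord {x y : R} : ∀ n i j k p q r, i + j + k = n → IsTwoWord x y i p →
    IsTwoWord x y j q → IsTwoWord x y k r → associator p q r = 0 := by
  intro n
  induction n using Nat.strong_induction_on with
  | _ n ih =>
    have ih : ∀ i j k p q r, i + j + k < n → IsTwoWord x y i p →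
      IsTwoWord x y j q → IsTwoWord x y k r → associator p q r = 0 :=
      fun i j k p q r hn => ih _ hn i j k p q r rfl
    have head : ∀ i p, IsTwoWord x y i p → 0 < i ∧ ∃ a, (a = x ∨ a = y) ∧
        (p = a ∨ ∃ i', i' + 1 = i ∧ ∃ p', IsTwoWord x y i' p' ∧ p = a * p') := by
      intro i p hp
      cases hp with
      | one a ha => exact ⟨one_pos, p, ha, .inl rfl⟩
      | cons a ha m p hp => exact ⟨m.succ_pos, a, ha, .inr ⟨m, rfl, p, hp, rfl⟩⟩
    intro i j k p q r hn hp hq hr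
    obtain ⟨hi, a, ha, hpa⟩ := head i p hp
    obtain ⟨hj, b, hb, hqb⟩ := head j q hq
    obtain ⟨hk, c, hc, hrc⟩ := head k r hr
    -- Three words in two letters: two of them begin with the same letter, and alternation moves
    -- these to the front.
    have key : a = b ∨ b = c ∨ a = c := by
      rcases ha with rfl | rfl <;> rcases hb with rfl | rfl <;> rcases hc with rfl | rfl <;> simp
    rcases key with rfl | rfl | rfl
    · exact h.associator_eq_zero_of_head ha ih hpa hqb hi hj hk hr hn
    · rw [h.cyc]
      exact h.associator_eq_zero_of_head hb ih hqb hrc hj hk hi hp (by omega)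
    · rw [h.swap_right, h.associator_eq_zero_of_head ha ih hpa hrc hi hk hj hq (by omega),
        neg_zero]

theorem mem_closure_mul {x y p q : R}
    (hp : p ∈ AddSubgroup.closure {p | ∃ n, IsTwoWord x y n p})
    (hq : q ∈ AddSubgroup.closure {p | ∃ n, IsTwoWord x y n p}) :
    p * q ∈ AddSubgroup.closure {p | ∃ n, IsTwoWord x y n p} := by
  induction hp, hq using AddSubgroup.closure_induction₂ with
  | mem p q hp hq =>
    obtain ⟨i, hp⟩ := hp
    obtain ⟨j, hq⟩ := hq
    exact AddSubgroup.subset_closure ⟨i + j, isTwoWord_mul (n := i + j + 1)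
      (fun i j k p q r _ => h.associator_isTwoWord _ i j k p q r rfl) hp hq (by omega)⟩
  | zero_left => rw [zero_mul]; exact zero_mem _
  | zero_right => rw [mul_zero]; exact zero_mem _
  | add_left a b c _ _ _ h1 h2 => rw [add_mul]; exact add_mem h1 h2
  | add_right a b c _ _ _ h1 h2 => rw [mul_add]; exact add_mem h1 h2
  | neg_left a b _ _ h1 => rw [neg_mul]; exact neg_mem h1
  | neg_right a b _ _ h1 => rw [mul_neg]; exact neg_mem h1

/-- Artin's theorem: two elements of an alternative ring lie in an associative subring. -/
theorem artin (x y : R) : ∃ S : NonUnitalSubring R, x ∈ S ∧ y ∈ S ∧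
    ∀ a ∈ S, ∀ b ∈ S, ∀ c ∈ S, associator a b c = 0 := by
  let S : NonUnitalSubring R :=
    { AddSubgroup.closure {p | ∃ n, IsTwoWord x y n p} with
      mul_mem' := h.mem_closure_mul }
  refine ⟨S, AddSubgroup.subset_closure ⟨1, .one x (.inl rfl)⟩,
    AddSubgroup.subset_closure ⟨1, .one y (.inr rfl)⟩, ?_⟩
  intro a (ha : a ∈ AddSubgroup.closure _) b (hb : b ∈ AddSubgroup.closure _) c
    (hc : c ∈ AddSubgroup.closure _)
  induction ha using AddSubgroup.closure_induction with
  | zero => exact associator_zero_left _ _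
  | add a a' _ _ e e' => rw [associator_add_left, e, e', add_zero]
  | neg a _ e => rw [associator_neg_left, e, neg_zero]
  | mem a ha =>
  induction hb using AddSubgroup.closure_induction with
  | zero => exact associator_zero_mid _ _
  | add a a' _ _ e e' => rw [associator_add_mid, e, e', add_zero]
  | neg a _ e => rw [h.swap_left, associator_neg_left, h.swap_left, e, neg_zero, neg_zero, neg_zero]
  | mem b hb =>
  induction hc using AddSubgroup.closure_induction with
  | zero => exact associator_zero_right _ _
  | add a a' _ _ e e' => rw [associator_add_right, e, e', add_zero]
  | neg a _ e => rw [associator_neg_right, e, neg_zero]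
  | mem c hc =>
    obtain ⟨i, ha⟩ := ha
    obtain ⟨j, hb⟩ := hb
    obtain ⟨k, hc⟩ := hc
    exact h.associator_isTwoWord _ i j k a b c rfl ha hb hc

omit h in
/-- Two elements of an alternative ring are the images of two elements under an injective
homomorphism from an associative ring. -/
theorem exists_associative_lift.{u} {R : Type u} [NonUnitalNonAssocRing R]
    (h : IsAlternativeRing R) (x y : R) : ∃ (S : Type u) (_ : NonUnitalRing S)
    (φ : S →ₙ+* R) (a b : S), Function.Injective φ ∧ φ a = x ∧ φ b = y := by
  obtain ⟨S, hx, hy, hS⟩ := h.artin x y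
  let inst : NonUnitalRing S :=
    { (inferInstance : NonUnitalNonAssocRing S) with
      mul_assoc := fun a b c => Subtype.ext (sub_eq_zero.mp (hS a a.2 b b.2 c c.2)) }
  exact ⟨S, inst, NonUnitalSubringClass.subtype S, ⟨x, hx⟩, ⟨y, hy⟩, Subtype.val_injective, rfl,
    rfl⟩

end IsAlternativeRing

/-! ### Powers of commutators and the nucleus -/

namespace IsAlternativeRing

variable {R : Type*} [NonUnitalNonAssocRing R] (h : IsAlternativeRing R)
include h

/-- `[x, y] (x, y, z) = (x, y, (x, y, z)) = - (x, y, z) [x, y]`. -/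
theorem commutator_mul_associator (x y z : R) :
    (x * y - y * x) * associator x y z = associator x y (associator x y z) ∧
    associator x y z * (x * y - y * x) = -associator x y (associator x y z) := by
  set a := associator x y z with ha
  have ha' : associator z x y = a := by rw [ha, h.cyc]
  -- The two claims come from evaluating the same value of f in the arrangements (x, y, xy, z), (xy,
  -- z, x, y) and, up to sign, (z, xy, x, y).
  have e0 : kleinfeld x y (x * y) z = associator x y a := by
    have e1 : associator x (x * y) z = a * x := by
      rw [h.swap_left, h.bump_right, h.swap_left y, neg_mul, neg_neg]
    have e2 : associator y (x * y) z = -(y * a) := by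
      rw [h.swap_left, h.bump_left]
    rw [kleinfeld, (h z (x * y)).2, e1, e2, h.cyc x y a]
    simp only [associator, neg_mul]
    abel
  have e3 := h.kleinfeld_pair x y (x * y) z
  have e4 := h.kleinfeld_swap_left (x * y) z x y
  rw [e3] at e0
  rw [e0] at e4
  have e5 : associator (x * y) x y = 0 := by rw [h.bump_right, h.self_outer, zero_mul]
  have f1 : associator ((x * y) * z) x y = (a * y) * x + associator x y a := by
    have : (x * y) * z = x * (y * z) + a := by rw [ha, associator]; abel
    rw [this, associator_add_left, h.bump_right, h.swap_right (y * z), h.bump_right,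
      h.swap_right z, ha', neg_mul, neg_mul, neg_mul, neg_neg, h.cyc a x y]
  have f2 : associator (z * (x * y)) x y = y * (x * a) - associator x y a := by
    have : z * (x * y) = (z * x) * y - a := by rw [← ha', associator]; abel
    rw [this, associator_sub_left, h.swap_right (z * x * y), h.bump_left,
      h.swap_right (z * x), h.bump_left, ha', mul_neg, neg_neg, h.cyc a]
  rw [kleinfeld, e5, f1, ha'] at e0
  rw [kleinfeld, e5, f2, ha'] at e4
  have g1 := h.cyc a x y
  have g2 := h.swap_left y x a
  rw [h.swap_right] at g1
  simp only [associator, mul_zero, zero_mul, mul_sub, sub_mul] at e0 e4 g1 g2 ⊢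
  constructor
  · linear_combination (norm := abel) - e4 - g2
  · linear_combination (norm := abel) - e0 - g1

theorem commutator_anticomm (x y z : R) :
    (x * y - y * x) * associator x y z + associator x y z * (x * y - y * x) = 0 := by
  rw [(h.commutator_mul_associator x y z).1, (h.commutator_mul_associator x y z).2, add_neg_cancel]

/-- The square of `[x, y]` associates with `x` and every `z`. -/
theorem associator_commutator_sq (x y z : R) :
    associator ((x * y - y * x) * (x * y - y * x)) x z = 0 := by
  have e1 : associator (x * y - y * x) x z = x * associator x y z - associator x y z * x := by
    rw [associator_sub_left, h.bump_right, h.bump_left, h.swap_left y, neg_mul, mul_neg]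
    abel
  -- Put a = (x, y, z). The substitutions zx and xz for z turn a into xa and ax, so v anticommutes
  -- with both and hence with [x, a] = (v, x, z).
  have e2 := h.commutator_anticomm x y (z * x)
  have e3 := h.commutator_anticomm x y (x * z)
  rw [h.associator_mul_fst'] at e2
  rw [h.associator_mul_fst] at e3
  rw [h.mul_self_left, e1]
  generalize x * y - y * x = v at *
  rw [mul_sub, sub_mul]
  linear_combination (norm := abel) e2 - e3

theorem associator_commutator_sq' (x y z : R) :
    associator ((x * y - y * x) * (x * y - y * x)) y z = 0 := by
  have e := h.associator_commutator_sq y x z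
  rwa [← neg_sub (x * y), neg_mul_neg] at e

/-- An element that associates with `x` and every `z` is well behaved with respect to
multiplication by `x` inside associators. -/
theorem associator_mul_of_commutes_associators {c x : R} (hx : ∀ z, associator c x z = 0) (z w : R) :
    associator c (x * z) w = associator c z w * x ∧
    associator c (z * x) w = x * associator c z w := by
  have hx' : ∀ z, associator z c x = 0 := fun z => by rw [h.cyc, hx]
  have hx'' : ∀ z, associator c z x = 0 := fun z => by rw [h.swap_right, hx, neg_zero]
  have e1 : kleinfeld z w c x = 0 := by simp only [kleinfeld, hx', mul_zero, zero_mul, sub_zero]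
  have e2 : kleinfeld z x c w = 0 := by
    rw [h.kleinfeld_cyc, h.kleinfeld_swap_left, h.kleinfeld_swap_right, h.kleinfeld_pair, e1]
    simp
  have e3 : kleinfeld x z c w = 0 := by rw [h.kleinfeld_swap_left, e2, neg_zero]
  have e4 : associator x c w = 0 := by rw [h.cyc, hx'']
  rw [kleinfeld, e4, zero_mul, sub_zero, sub_eq_zero, h.swap_left, h.swap_left z, mul_neg,
    neg_inj] at e2
  rw [kleinfeld, e4, mul_zero, sub_zero, sub_eq_zero, h.swap_left, h.swap_left z, neg_mul,
    neg_inj] at e3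
  exact ⟨e3, e2⟩

/-- Put F = (c, z, w). Factors x and y can be pulled out of either slot of (c, ·, ·). Pulling them
out of (c, xz, yw) in both orders gives (Fy)x = (Fx)y; the variants with factors on the other side
show that x, y, F associate. -/
theorem associator_mul_commutator_eq_zero {c x y : R} (hx : ∀ z, associator c x z = 0)
    (hy : ∀ z, associator c y z = 0) (z w : R) :
    associator c z w * (x * y - y * x) = 0 ∧ (x * y - y * x) * associator c z w = 0 := by
  have l : ∀ {u : R}, (∀ z, associator c u z = 0) → ∀ z w,
      associator c z (u * w) = associator c z w * u ∧
      associator c z (w * u) = u * associator c z w := by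
    intro u hu z w
    have := h.associator_mul_of_commutes_associators hu w z
    rw [h.swap_right, this.1, h.swap_right c z (w * u), this.2, h.swap_right c w z, neg_mul,
      neg_neg, mul_neg, neg_neg]
    exact ⟨rfl, rfl⟩
  have r : ∀ {u : R}, (∀ z, associator c u z = 0) → ∀ z w,
      associator c (u * z) w = associator c z w * u ∧
      associator c (z * u) w = u * associator c z w :=
    fun hu => h.associator_mul_of_commutes_associators hu
  have e1 : associator c z w * y * x = associator c z w * x * y := by
    rw [← (l hy z w).1, ← (r hx z (y * w)).1, (l hy (x * z) w).1, (r hx z w).1]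
  have e2 : y * associator c z w * x = y * (associator c z w * x) := by
    rw [← (l hy z w).2, ← (r hx z (w * y)).1, (l hy (x * z) w).2, (r hx z w).1]
  have e3 : x * (y * associator c z w) = y * (x * associator c z w) := by
    rw [← (l hy z w).2, ← (r hx z (w * y)).2, (l hy (z * x) w).2, (r hx z w).2]
  generalize associator c z w = F at *
  have e4 : associator y F x = 0 := sub_eq_zero.mpr e2
  have e5 : associator F x y = 0 := by rw [← h.cyc, e4]
  have e6 : associator x y F = 0 := by rw [← h.cyc, e5]
  have e7 : associator F y x = 0 := by rw [h.swap_right, e5, neg_zero]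
  have e8 : associator y x F = 0 := by rw [h.swap_left, e6, neg_zero]
  simp only [associator] at e5 e6 e7 e8
  constructor
  · rw [mul_sub]
    linear_combination (norm := abel) e7 - e5 - e1
  · rw [sub_mul]
    linear_combination (norm := abel) e6 - e8 + e3

theorem commutator_mul_associator_sq (x y z w : R) :
    associator ((x * y - y * x) * (x * y - y * x)) z w * (x * y - y * x) = 0 ∧
    (x * y - y * x) * associator ((x * y - y * x) * (x * y - y * x)) z w = 0 :=
  h.associator_mul_commutator_eq_zero (h.associator_commutator_sq x y)
    (h.associator_commutator_sq' x y) z w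

/-- Fourth powers of commutators lie in the nucleus. -/
theorem commutator_pow_four_mem_ringNucleus (x y : R) :
    (x * y - y * x) * (x * y - y * x) * ((x * y - y * x) * (x * y - y * x)) ∈ ringNucleus R := by
  intro z w
  obtain ⟨e1, e2⟩ := h.commutator_mul_associator_sq x y z w
  rw [h.mul_self_left]
  generalize x * y - y * x = v at *
  -- As v kills F = (v², z, w) on both sides, so does v² by alternativity, and (v⁴, z, w) = v²F +
  -- Fv².
  have e3 := (h (associator (v * v) z w) v).2
  have e4 := (h (associator (v * v) z w) v).1
  rw [associator, e2, mul_zero, sub_zero] at e3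
  rw [associator, e1, zero_mul, zero_sub, neg_eq_zero] at e4
  rw [e3, e4, add_zero]

end IsAlternativeRing

/-! ### Regular commutators exclude zero divisors -/

/-- A commutator annihilating a non-zero element on both sides is zero. -/
def CommutatorsRegular (R : Type*) [NonUnitalNonAssocRing R] : Prop :=
  ∀ x y r : R, (x * y - y * x) * r = 0 → r * (x * y - y * x) = 0 → x * y - y * x = 0 ∨ r = 0

theorem CommutatorsRegular.eq_zero_of_sq {R : Type*} [NonUnitalNonAssocRing R]
    (hc : CommutatorsRegular R) {x y : R} (e : (x * y - y * x) * (x * y - y * x) = 0) :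
    x * y - y * x = 0 := by
  rcases hc x y _ e e with h | h <;> exact h

/-- With v = [z, w], the last two hypotheses say that vw and zv commute with zw. As v commutes with
z and w, they become v[zw, w] = 0 and v[zw, z] = 0, that is v²w = v²z = 0; then v²(zw - wz) = 0. -/
theorem commutator_cube_eq_zero {S : Type*} [NonUnitalRing S] {z w : S}
    (e1 : z * (z * w - w * z) = (z * w - w * z) * z)
    (e2 : w * (z * w - w * z) = (z * w - w * z) * w)
    (e3 : (z * w) * ((z * w) * w - w * (z * w)) = ((z * w) * w - w * (z * w)) * (z * w))
    (e4 : (z * w) * ((z * w) * z - z * (z * w)) = ((z * w) * z - z * (z * w)) * (z * w)) :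
    (z * w - w * z) * ((z * w - w * z) * (z * w - w * z)) = 0 := by
  have f1 : (z * w) * w - w * (z * w) = (z * w - w * z) * w := by noncomm_ring
  have f2 : (z * w) * z - z * (z * w) = -(z * (z * w - w * z)) := by noncomm_ring
  rw [f1] at e3
  rw [f2] at e4
  obtain ⟨v, hv⟩ : ∃ v, v = z * w - w * z := ⟨_, rfl⟩
  rw [← hv] at e1 e2 e3 e4 ⊢
  have g1 : z * w * (v * w) = v * (z * w) * w := by
    rw [mul_assoc z, ← mul_assoc w v, e2, mul_assoc v, ← mul_assoc z v, e1]; simp only [mul_assoc]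
  have g2 : z * w * (z * v) = v * (z * w) * z := by
    rw [e1, ← mul_assoc, mul_assoc z, e2, ← mul_assoc z, e1, mul_assoc v]
  have h1 : v * (v * w) = 0 := by
    nth_rewrite 2 [hv]
    rw [sub_mul, mul_sub, sub_eq_zero, ← mul_assoc, ← g1, e3]; simp only [mul_assoc]
  have h2 : v * (v * z) = 0 := by
    rw [← e1]
    nth_rewrite 2 [hv]
    rw [mul_neg, neg_mul, neg_inj, g2, e1] at e4
    rw [mul_sub, mul_sub, sub_eq_zero, ← mul_assoc v z, ← e4]; simp only [mul_assoc]
  nth_rewrite 3 [hv]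
  rw [mul_sub, mul_sub, ← mul_assoc v z, ← mul_assoc v w, ← mul_assoc v (v * z),
    ← mul_assoc v (v * w), h1, h2, zero_mul, zero_mul, sub_zero]

namespace IsAlternativeRing

variable {R : Type*} [NonUnitalNonAssocRing R] (h : IsAlternativeRing R)
include h

theorem commutator_mul (x y z : R) :
    (x * y * z - z * (x * y)) - x * (y * z - z * y) - (x * z - z * x) * y =
      3 • associator x y z := by
  have e1 := h.cyc z x y
  have e2 := h.swap_right x y z
  simp only [associator, mul_sub, sub_mul] at e1 e2 ⊢
  linear_combination (norm := abel) e1 - e2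

theorem exists_mul_ne_mul (hnonassoc : ¬ IsAssociativeRing R) (hT : HypT1 R ∨ HypT2 R) :
    ∃ x y : R, x * y - y * x ≠ 0 := by
  by_contra! hcomm
  have hcomm' : ∀ x y : R, x * y = y * x := fun x y => sub_eq_zero.mp (hcomm x y)
  apply hnonassoc
  intro x y z
  rcases hT with hT | hT
  · apply hT
    rw [← h.commutator_mul, hcomm, hcomm, hcomm, mul_zero, zero_mul, sub_zero, sub_zero]
  · exact hT.1 ⊤ (fun x _ y _ => hcomm' x y) x trivial y trivial z trivial

/-- A right ideal consisting of commuting elements is zero. -/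
theorem eq_zero_of_mem_commuting_ideal (hc : CommutatorsRegular R) (hT : HypT1 R ∨ HypT2 R)
    (hne : ∃ x y : R, x * y - y * x ≠ 0) {I : Set R} (hI : ∀ y ∈ I, ∀ z, y * z ∈ I)
    (hcomm : ∀ y ∈ I, ∀ z, y * z - z * y = 0) {y : R} (hy : y ∈ I) : y = 0 := by
  by_contra hy0
  have hcy : ∀ z, y * z = z * y := fun z => sub_eq_zero.mp (hcomm y hy z)
  have reg : ∀ z w, (z * w - w * z) * y = 0 → z * w - w * z = 0 := fun z w e =>
    (hc z w y e ((hcy _).trans e)).resolve_right hy0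
  -- The identity for [zy, w] and for [yz, w] gives opposite values to [z, w]y, so 2[z, w]y = 0 and
  -- regularity yields 2[z, w] = 0.
  have a1 : ∀ z w, (z * w - w * z) * y = 3 • associator y z w := by
    intro z w
    have e := h.commutator_mul z y w
    rw [← hcy z, hcomm _ (hI y hy z), hcomm y hy, mul_zero, h.swap_left z y] at e
    linear_combination (norm := abel) -e
  have a2 : ∀ z w, (z * w - w * z) * y = -(3 • associator y z w) := by
    intro z w
    have e := h.commutator_mul y z w
    rw [hcomm _ (hI y hy z), hcomm y hy, zero_mul, hcy] at e
    linear_combination (norm := abel) -e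
  have a3 : ∀ z w : R, 2 • (z * w - w * z) = 0 := by
    intro z w
    have e := reg (2 • z) w (by
      have : 2 • z * w - w * 2 • z = (z * w - w * z) + (z * w - w * z) := by
        rw [two_nsmul, add_mul, mul_add]; abel
      rw [this, add_mul]
      nth_rewrite 2 [a2]
      rw [a1, add_neg_cancel])
    rw [← e, two_nsmul, two_nsmul, add_mul, mul_add]; abel
  rcases hT with hT | hT
  swap
  · obtain ⟨z, w, hzw⟩ := hne
    exact hzw (hT.2 _ (a3 z w))
  have a4 : ∀ z w, (z * w - w * z) * y = associator y z w := by
    intro z w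
    have e : 2 • associator y z w = 0 := by
      apply hT
      have := a1 z w
      rw [a2 z w] at this
      linear_combination (norm := abel) -this
    rw [a1, succ_nsmul, e, zero_add]
  -- With v = [z, w], `a4` turns [z, v]y into (y, z, v) = (z, v, y), and (zv)y = [z, zw]y = (y, z,
  -- zw) = (vy)z = z(vy).
  have a5 : ∀ z w : R, z * (z * w - w * z) = (z * w - w * z) * z := by
    intro z w
    rw [← sub_eq_zero]
    apply reg
    have e1 : z * (z * w - w * z) = z * (z * w) - z * w * z := by
      have := h.self_outer z w
      rw [associator, sub_eq_zero] at this
      rw [mul_sub, this]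
    have e2 := a4 z (z * w)
    rw [h.associator_mul_snd, ← a4, ← e1] at e2
    have e3 := hcomm y hy (z * w - w * z)
    have e4 := hcomm _ (hI y hy (z * w - w * z)) z
    rw [sub_eq_zero] at e3 e4
    rw [← e3, e4] at e2
    rw [a4, h.cyc, associator, e2, ← e3, sub_self]
  obtain ⟨z, w, hzw⟩ := hne
  obtain ⟨S, _, φ, z', w', hφ, rfl, rfl⟩ := h.exists_associative_lift z w
  apply hzw
  have b1 := a5 (φ z') (φ w')
  have b2 := a5 (φ w') (φ z')
  have b3 := a5 (φ z' * φ w') (φ w')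
  have b4 := a5 (φ z' * φ w') (φ z')
  rw [← neg_sub (φ z' * φ w'), mul_neg, neg_mul, neg_inj] at b2
  simp only [← map_mul, ← map_sub] at b1 b2 b3 b4
  have b5 := commutator_cube_eq_zero (hφ b1) (hφ b2) (hφ b3) (hφ b4)
  have b6 := congrArg φ b5
  rw [← mul_assoc] at b5
  have b7 := congrArg φ b5
  simp only [map_mul, map_sub, map_zero] at b6 b7
  rcases hc _ _ _ b6 b7 with b | b
  · exact b
  · exact hc.eq_zero_of_sq b

/-- If xy = 0 then [x, y]² = (yx)² = y(xy)x = 0. Only the absence of square-zero commutators is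
assumed, so that this is available under (H3) before regularity is known. -/
theorem mul_eq_zero_symm (hc : ∀ x y : R, (x * y - y * x) * (x * y - y * x) = 0 →
    x * y - y * x = 0) {x y : R} (e : x * y = 0) : y * x = 0 := by
  have e1 := hc x y (by
    rw [e, zero_sub, neg_mul_neg]
    obtain ⟨S, _, φ, x, y, hφ, rfl, rfl⟩ := h.exists_associative_lift x y
    rw [← map_mul, map_eq_zero_iff φ hφ] at e
    rw [← map_mul, ← map_mul, mul_assoc, ← mul_assoc x, e, zero_mul, mul_zero, map_zero])
  rw [e, zero_sub, neg_eq_zero] at e1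
  exact e1

/-- For x² = 0 the commutator [x, xy] = -xyx squares to zero, so xyx = 0; then [x, y]² = 0, so x
commutes with everything. Since also (xz)² = (xzx)z = 0, the square-zero elements form a commuting
right ideal. -/
theorem eq_zero_of_mul_self (hc : CommutatorsRegular R) (hT : HypT1 R ∨ HypT2 R)
    (hne : ∃ x y : R, x * y - y * x ≠ 0) {x : R} (e : x * x = 0) : x = 0 := by
  have e1 : ∀ x : R, x * x = 0 → ∀ y, x * y * x = 0 := by
    intro x e y
    have e1 : x * (x * y) - x * y * x = 0 := hc.eq_zero_of_sq (by
      obtain ⟨S, _, φ, x, y, hφ, rfl, rfl⟩ := h.exists_associative_lift x y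
      rw [← map_mul, map_eq_zero_iff φ hφ] at e
      simp only [← map_mul, ← map_sub]
      rw [← mul_assoc x x, e, zero_mul, zero_sub, neg_mul_neg, mul_assoc, ← mul_assoc x (x * y),
        ← mul_assoc x x, e, zero_mul, zero_mul, mul_zero, map_zero])
    have e2 := (h y x).2
    rw [associator, e, zero_mul, zero_sub, neg_eq_zero] at e2
    rwa [e2, zero_sub, neg_eq_zero] at e1
  have e2 : ∀ x : R, x * x = 0 → ∀ y, x * y - y * x = 0 := by
    intro x e y
    have e3 := e1 x e y
    have e4 := e1 x e (y * y)
    apply hc.eq_zero_of_sq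
    obtain ⟨S, _, φ, x, y, hφ, rfl, rfl⟩ := h.exists_associative_lift x y
    simp only [← map_mul, ← map_sub, map_eq_zero_iff φ hφ] at e e3 e4 ⊢
    have : (x * y - y * x) * (x * y - y * x) =
      x * y * x * y - x * (y * y) * x - y * (x * x) * y + y * (x * y * x) := by noncomm_ring
    rw [this, e, e3, e4]
    simp
  refine h.eq_zero_of_mem_commuting_ideal hc hT hne (I := {x | x * x = 0}) ?_ e2 e
  intro x (e : x * x = 0) z
  have e3 := e1 x e z
  show x * z * (x * z) = 0
  obtain ⟨S, _, φ, x, z, hφ, rfl, rfl⟩ := h.exists_associative_lift x z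
  simp only [← map_mul, map_eq_zero_iff φ hφ] at e3 ⊢
  rw [← mul_assoc, e3, zero_mul]

/-- An alternative ring with regular commutators has no zero divisors. -/
theorem eq_zero_or_eq_zero_of_mul_eq_zero (hc : CommutatorsRegular R) (hT : HypT1 R ∨ HypT2 R)
    (hne : ∃ x y : R, x * y - y * x ≠ 0) {x y : R} (e : x * y = 0) : x = 0 ∨ y = 0 := by
  have symm : ∀ {x y : R}, x * y = 0 → y * x = 0 :=
    fun e => h.mul_eq_zero_symm (fun _ _ => hc.eq_zero_of_sq) e
  -- Here (ux)² = u(xux) = 0. With the middle Moufang identity this makes the annihilator of x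
  -- closed under multiplication by R on both sides.
  have key : ∀ {x u : R}, x * (u * x) = 0 → x * u = 0 := by
    intro x u e
    apply symm
    apply h.eq_zero_of_mul_self hc hT hne
    obtain ⟨S, _, φ, x, u, hφ, rfl, rfl⟩ := h.exists_associative_lift x u
    simp only [← map_mul, map_eq_zero_iff φ hφ] at e ⊢
    rw [mul_assoc, e, mul_zero]
  have idl : ∀ {x y : R}, x * y = 0 → ∀ z, x * (y * z) = 0 ∧ x * (z * y) = 0 := by
    intro x y e z
    constructor
    · apply key
      rw [← h.middle_moufang, e, zero_mul]
    · apply key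
      rw [← h.middle_moufang, symm e, mul_zero]
  by_cases hx : x = 0
  · exact .inl hx
  refine .inr (h.eq_zero_of_mem_commuting_ideal hc hT hne (I := {y | x * y = 0})
    (fun y e z => (idl e z).1) ?_ e)
  intro y e z
  -- Commutators with an annihilator element annihilate x, hence vanish by regularity as x ≠ 0.
  have e1 : x * (y * z - z * y) = 0 := by rw [mul_sub, (idl e z).1, (idl e z).2, sub_zero]
  exact (hc _ _ _ (symm e1) e1).resolve_right hx

omit h in
theorem _root_.HypH1.commutatorsRegular (hH : HypH1 R) : CommutatorsRegular R := by
  intro x y r e1 e2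
  by_contra! hne
  exact hH _ ⟨x, y, rfl⟩ hne.1 ⟨hne.1, ⟨r, hne.2, e1⟩, ⟨r, hne.2, e2⟩⟩

theorem commutatorsRegular_of_hypH2 (hH : HypH2 R) : CommutatorsRegular R := by
  intro x y r e1 e2
  by_contra! hne
  have hN := h.commutator_pow_four_mem_ringNucleus x y
  have h0 := hH.1 _ ⟨x, y, rfl⟩ hne.1
  generalize x * y - y * x = v at *
  have sq : ∀ u : R, u * r = 0 → r * u = 0 → u * u * r = 0 ∧ r * (u * u) = 0 := by
    intro u e1 e2
    have e3 := (h r u).1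
    have e4 := (h r u).2
    rw [associator, e2, zero_mul, zero_sub, neg_eq_zero] at e3
    rw [associator, e1, mul_zero, sub_zero] at e4
    exact ⟨e4, e3⟩
  obtain ⟨e3, e4⟩ := sq _ e1 e2
  obtain ⟨e5, e6⟩ := sq _ e3 e4
  have hv : v * v * (v * v) ≠ 0 := by
    intro e
    apply h0
    -- Index 3 of `ringPow` is the fourth power.
    refine ⟨3, ?_⟩
    show v * v * v * v = 0
    rw [← e]
    obtain ⟨S, _, φ, v, -, hφ, rfl, -⟩ := h.exists_associative_lift v v
    simp only [← map_mul, mul_assoc]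
  exact hH.2 _ hN hv ⟨hv, ⟨r, hne.2, e5⟩, ⟨r, hne.2, e6⟩⟩

theorem hypH2_of_hypH3 (hH : HypH3 R) : HypH2 R := by
  obtain ⟨hnil, ⟨e, he⟩, hsimple⟩ := hH
  refine ⟨hnil, ?_⟩
  rintro n hn hn0 ⟨-, ⟨y, hy0, hy⟩, -⟩
  have symm : ∀ {x y : R}, x * y = 0 → y * x = 0 := by
    intro x y
    refine h.mul_eq_zero_symm fun x y e => ?_
    by_contra hne
    exact hnil _ ⟨x, y, rfl⟩ hne ⟨1, e⟩
  have nuc : ∀ m ∈ ringNucleus R, ∀ x y : R, m * x * y = m * (x * y) :=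
    fun m hm x y => sub_eq_zero.mp (hm x y)
  -- The nuclear elements killing whatever n kills. Closure on the right uses that xy = 0 implies yx
  -- = 0. Since n ≠ 0 lies in J, simplicity puts the identity there, so n kills nothing non-zero.
  let J : TwoSidedIdeal (ringNucleus R) := TwoSidedIdeal.mk'
    {m | ∀ i, n * i = 0 → (m : R) * i = 0}
    (fun i _ => by simp) (fun {a b} ha hb i hi => by simp [add_mul, ha i hi, hb i hi])
    (fun {a} ha i hi => by simp [ha i hi])
    (fun {a b} hb i hi => by
      show (a : R) * b * i = 0
      rw [nuc a a.2, hb i hi, mul_zero])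
    (fun {a b} ha i hi => by
      show (a : R) * b * i = 0
      rw [nuc a a.2]
      apply ha
      apply symm
      rw [nuc b b.2, symm hi, mul_zero])
  have he' : e ∈ ringNucleus R := fun x y => by simp [associator, (he _).1]
  have hnJ : (⟨n, hn⟩ : ringNucleus R) ∈ J := by
    rw [TwoSidedIdeal.mem_mk']
    exact fun i hi => hi
  rcases hsimple.simple.eq_bot_or_eq_top J with hJ | hJ
  · rw [hJ, TwoSidedIdeal.mem_bot] at hnJ
    exact hn0 (congrArg Subtype.val hnJ)
  · have heJ : (⟨e, he'⟩ : ringNucleus R) ∈ J := by rw [hJ]; trivial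
    rw [TwoSidedIdeal.mem_mk'] at heJ
    have := heJ y hy
    rw [(he y).1] at this
    exact hy0 this

theorem commutatorsRegular (hH : HypH1 R ∨ HypH2 R ∨ HypH3 R) : CommutatorsRegular R := by
  rcases hH with hH | hH | hH
  · exact hH.commutatorsRegular
  · exact h.commutatorsRegular_of_hypH2 hH
  · exact h.commutatorsRegular_of_hypH2 (h.hypH2_of_hypH3 hH)

end IsAlternativeRing

/-! ### The nucleus is central -/

namespace IsAlternativeRing

variable {R : Type*} [NonUnitalNonAssocRing R] (h : IsAlternativeRing R)
include h

theorem associator_mid_eq_zero {n : R} (hn : n ∈ ringNucleus R) (x y : R) :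
    associator x n y = 0 := by
  rw [h.swap_left, hn, neg_zero]

/-- `[n, x] (x, y, z) = 0` for `n` in the nucleus. -/
theorem nucleus_commutator_mul_associator {n : R} (hn : n ∈ ringNucleus R) (x y z : R) :
    (n * x - x * n) * associator x y z = 0 := by
  have nuc : ∀ x y : R, n * x * y = n * (x * y) := fun x y => sub_eq_zero.mp (hn x y)
  have nuc' : ∀ x y : R, x * n * y = x * (n * y) := fun x y =>
    sub_eq_zero.mp (h.associator_mid_eq_zero hn x y)
  have e1 : ∀ x y z, associator (n * x) y z = n * associator x y z := by
    intro x y z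
    have e := teichmuller n x y z
    rwa [hn, hn, hn, zero_mul, add_zero, sub_zero, add_zero] at e
  have e2 : ∀ x y z, n * associator x y z = associator x y z * n := by
    intro x y z
    have e : kleinfeld n x y z = 0 := by
      rw [h.kleinfeld_pair, kleinfeld, h.associator_mid_eq_zero hn, h.associator_mid_eq_zero hn,
        h.associator_mid_eq_zero hn]
      simp
    rwa [kleinfeld, hn, mul_zero, sub_zero, e1, sub_eq_zero] at e
  have e3 : kleinfeld (n * x) x y z = 0 := by
    have e : ∀ p, associator p (n * x) x = 0 := fun p => by
      rw [h.cyc, e1, (h p x).2, mul_zero]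
    rw [h.kleinfeld_pair, kleinfeld, e, e, e]
    simp
  have e4 := e2 x y z
  rw [kleinfeld, nuc, e1, e1, h.mul_self_left] at e3
  generalize associator x y z = a at *
  rw [← nuc' a x, ← e4, nuc a x, mul_add, ← nuc x a, ← nuc' x a] at e3
  rw [sub_mul]
  linear_combination (norm := abel) e3

/-- [n, x](x, y, z) = 0 settles every x with (x, y, z) ≠ 0. Any other x is the difference of x + w
and w, both of this kind, where (w, y, z) ≠ 0. -/
theorem nucleus_comm (hd : ∀ x y : R, x * y = 0 → x = 0 ∨ y = 0)
    (hnonassoc : ¬ IsAssociativeRing R) {n : R} (hn : n ∈ ringNucleus R) (x : R) :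
    n * x - x * n = 0 := by
  have key : ∀ x y z : R, associator x y z ≠ 0 → n * x - x * n = 0 := fun x y z e =>
    (hd _ _ (h.nucleus_commutator_mul_associator hn x y z)).resolve_right e
  obtain ⟨w, y, z, hw⟩ : ∃ w y z : R, associator w y z ≠ 0 := by
    by_contra! e
    exact hnonassoc e
  by_cases hx : associator x y z = 0
  · have e := key (x + w) y z (by rwa [associator_add_left, hx, zero_add])
    have e' := key w y z hw
    rw [mul_add, add_mul] at e
    linear_combination (norm := abel) e - e'
  · exact key x y z hx

theorem commutator_sq_mem_center (hd : ∀ x y : R, x * y = 0 → x = 0 ∨ y = 0)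
    (hnonassoc : ¬ IsAssociativeRing R) (x y : R) :
    (x * y - y * x) * (x * y - y * x) ∈ NonUnitalSubring.center R := by
  rw [mem_center_iff_mem_ringNucleus h]
  have hN : (x * y - y * x) * (x * y - y * x) ∈ ringNucleus R := by
    intro z w
    rcases hd _ _ (h.commutator_mul_associator_sq x y z w).1 with e | e
    · exact e
    · rw [e, mul_zero, associator_zero_left]
  exact ⟨hN, h.nucleus_comm hd hnonassoc hN⟩

end IsAlternativeRing

/-! ### Quadratic equations and the scalar part -/

section QuadraticAlgebras

variable {K A : Type*} [Field K] [NonAssocRing A] [Module K A] [IsScalarTower K A A]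
  [SMulCommClass K A A]

/-- If v = [x, y] ≠ 0, then [x, yx] = vx and [x, y + yx] = v + vx also have scalar squares β and δ.
With v² = α, expanding the last square gives vxv = (δ - α - β) - αx, and multiplying by x gives β =
(δ - α - β)x - αx². If x commutes with everything, [xz, w] = x[z, w], and its square is x²[z, w]².
-/
theorem IsAlternativeRing.exists_quadratic (h : IsAlternativeRing A)
    (hd : ∀ x y : A, x * y = 0 → x = 0 ∨ y = 0) (h2 : (2 : K) ≠ 0)
    (hsq : ∀ x y : A, ∃ k : K, (x * y - y * x) * (x * y - y * x) = k • 1)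
    (hne : ∃ x y : A, x * y - y * x ≠ 0) (x : A) : ∃ t n : K, x * x = t • x + n • 1 := by
  by_cases hx : ∃ y, x * y - y * x ≠ 0
  · obtain ⟨y, hv⟩ := hx
    obtain ⟨α, hα⟩ := hsq x y
    obtain ⟨β, hβ⟩ := hsq x (y * x)
    obtain ⟨δ, hδ⟩ := hsq x (y + y * x)
    have e1 : x * (y * x) - y * x * x = (x * y - y * x) * x := by
      obtain ⟨S, _, φ, x, y, -, rfl, rfl⟩ := h.exists_associative_lift x y
      simp only [← map_mul, ← map_sub]
      congr 1
      noncomm_ring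
    have e2 : x * (y + y * x) - (y + y * x) * x = (x * y - y * x) + (x * y - y * x) * x := by
      rw [← e1, mul_add, add_mul]; abel
    rw [e1] at hβ
    rw [e2] at hδ
    generalize x * y - y * x = v at *
    have e3 : v * (v * x) = α • x := by
      rw [← sub_eq_zero.mp (h x v).2, hα, smul_mul_assoc, one_mul]
    have e4 : v * x * (v * x) = v * x * v * x := by
      obtain ⟨S, _, φ, x, v, -, rfl, rfl⟩ := h.exists_associative_lift x v
      simp only [← map_mul, mul_assoc]
    have e5 : v * x * v = (δ - α - β) • (1 : A) - α • x := by
      rw [mul_add, add_mul, add_mul, hα, hβ, e3] at hδ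
      linear_combination (norm := module) hδ
    rw [e4, e5, sub_mul, smul_mul_assoc, smul_mul_assoc, one_mul] at hβ
    have hα0 : α ≠ 0 := by
      rintro rfl
      rw [zero_smul] at hα
      rcases hd _ _ hα with e | e <;> exact hv e
    refine ⟨α⁻¹ * (δ - α - β), -(α⁻¹ * β), ?_⟩
    have e6 : α • (x * x) = (δ - α - β) • x - β • (1 : A) := by
      linear_combination (norm := module) -hβ
    rw [← inv_smul_smul₀ hα0 (x * x), e6]
    module
  · push Not at hx
    obtain ⟨z, w, hv⟩ := hne
    have e1 := h.commutator_mul x z w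
    have e2 := h.commutator_mul z x w
    -- Subtracting the identities for [xz, w] and [zx, w] leaves 6(x, z, w) = 0; no division by 3 is
    -- needed.
    have e3 : (2 : K) • (3 • associator x z w) = 0 := by
      have e5 := hx (z * w - w * z)
      rw [hx, zero_mul] at e1
      rw [hx, mul_zero, h.swap_left z, ← sub_eq_zero.mp (hx z)] at e2
      rw [two_smul]
      linear_combination (norm := abel) - e1 + e2 - e5
    rw [smul_eq_zero_iff_right h2] at e3
    rw [e3, hx, zero_mul, sub_zero, sub_eq_zero] at e1
    obtain ⟨α, hα⟩ := hsq z w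
    obtain ⟨β, hβ⟩ := hsq (x * z) w
    rw [e1] at hβ
    have e4 := hx (z * w - w * z)
    generalize z * w - w * z = v at *
    have e6 : x * v * (x * v) = x * x * (v * v) := by
      obtain ⟨S, _, φ, x, v, hφ, rfl, rfl⟩ := h.exists_associative_lift x v
      rw [sub_eq_zero] at e4
      simp only [← map_mul] at e4 ⊢
      have e4 := hφ e4
      rw [mul_assoc, ← mul_assoc v x, ← e4]
      simp only [mul_assoc]
    rw [e6, hα, mul_smul_comm, mul_one] at hβ
    have hα0 : α ≠ 0 := by
      rintro rfl
      rw [zero_smul] at hα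
      rcases hd _ _ hα with e | e <;> exact hv e
    refine ⟨0, α⁻¹ * β, ?_⟩
    rw [← inv_smul_smul₀ hα0 (x * x), hβ]
    module

/-- `u = 0` or `u` is not a scalar, and the square of `u` is a scalar. -/
def IsPure (K : Type*) {A : Type*} [Field K] [NonAssocRing A] [Module K A] (u : A) : Prop :=
  (∃ k : K, u * u = k • 1) ∧ ((∃ k : K, u = k • 1) → u = 0)

omit [IsScalarTower K A A] [SMulCommClass K A A] in
theorem isPure_zero : IsPure K (0 : A) := ⟨⟨0, by simp⟩, fun _ => rfl⟩

theorem IsPure.smul {u : A} (hu : IsPure K u) (c : K) : IsPure K (c • u) := by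
  obtain ⟨⟨k, hk⟩, hu⟩ := hu
  by_cases hc : c = 0
  · rw [hc, zero_smul]; exact isPure_zero
  refine ⟨⟨c * c * k, ?_⟩, ?_⟩
  · rw [smul_mul_assoc, mul_smul_comm, hk]; module
  · rintro ⟨l, hl⟩
    rw [hu ⟨c⁻¹ * l, by rw [mul_smul, ← hl, inv_smul_smul₀ hc]⟩, smul_zero]

/-- If 1, u, w are independent, (u + w)² + (u - w)² = 2u² + 2w² is scalar, which forces both linear
coefficients to vanish. If w = au + b with u not scalar, the cross term 2abu of w² forces ab = 0. -/
theorem IsPure.add (h2 : (2 : K) ≠ 0) (hq : ∀ x : A, ∃ t n : K, x * x = t • x + n • 1) {u w : A}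
    (hu : IsPure K u) (hw : IsPure K w) : IsPure K (u + w) := by
  obtain ⟨k, hk⟩ := hu.1
  obtain ⟨l, hl⟩ := hw.1
  by_cases hu1 : ∃ k : K, u = k • 1
  · rwa [hu.2 hu1, zero_add]
  by_cases hw1 : ∃ a b : K, w = a • u + b • 1
  · obtain ⟨a, b, rfl⟩ := hw1
    by_cases ha : a = 0
    · have := hw.2 ⟨b, by rw [ha, zero_smul, zero_add]⟩
      rwa [this, add_zero]
    by_cases hb : b = 0
    · rw [hb, zero_smul, add_zero]
      have := hu.smul (1 + a)
      rwa [add_smul, one_smul] at this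
    refine absurd ⟨(2 * a * b)⁻¹ * (l - a * a * k - b * b), ?_⟩ hu1
    have hc : 2 * a * b ≠ 0 := by positivity
    rw [mul_smul, eq_inv_smul_iff₀ hc]
    simp only [mul_add, add_mul, smul_mul_assoc, mul_smul_comm, one_mul, mul_one, hk] at hl
    linear_combination (norm := module) hl
  · have indep : ∀ p q r : K, p • u + q • w = r • (1 : A) → p = 0 ∧ q = 0 := by
      intro p q r e
      have hq0 : q = 0 := by
        by_contra hq0
        refine hw1 ⟨-(q⁻¹ * p), q⁻¹ * r, ?_⟩
        rw [← inv_smul_smul₀ hq0 w, ← sub_eq_iff_eq_add'.mpr e.symm]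
        module
      refine ⟨?_, hq0⟩
      by_contra hp0
      refine hu1 ⟨p⁻¹ * r, ?_⟩
      rw [mul_smul, ← e, hq0, zero_smul, add_zero, inv_smul_smul₀ hp0]
    obtain ⟨t1, n1, e1⟩ := hq (u + w)
    obtain ⟨t2, n2, e2⟩ := hq (u - w)
    have e3 := indep (t1 + t2) (t1 - t2) (2 * k + 2 * l - n1 - n2) (by
      simp only [mul_add, add_mul, mul_sub, sub_mul, hk, hl] at e1 e2
      linear_combination (norm := module) - e1 - e2)
    have ht : t1 = 0 := by
      have : 2 * t1 = 0 := by linear_combination e3.1 + e3.2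
      exact (mul_eq_zero.mp this).resolve_left h2
    refine ⟨⟨n1, by rw [e1, ht, zero_smul, zero_add]⟩, ?_⟩
    rintro ⟨c, hc⟩
    have := indep 1 1 c (by rw [one_smul, one_smul, hc])
    exact absurd this.1 one_ne_zero

/-- The projection to the scalars along the pure elements. -/
theorem exists_scalar_part [Nontrivial A] (h2 : (2 : K) ≠ 0)
    (hq : ∀ x : A, ∃ t n : K, x * x = t • x + n • 1) :
    ∃ s : A →ₗ[K] K, s 1 = 1 ∧ ∀ u, s u = 0 → ∃ k : K, u * u = k • 1 := by
  have ex : ∀ x : A, ∃ s : K, IsPure K (x - s • 1) := by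
    intro x
    by_cases hx : ∃ k : K, x = k • 1
    · obtain ⟨k, rfl⟩ := hx
      exact ⟨k, by rw [sub_self]; exact isPure_zero⟩
    · obtain ⟨t, n, e⟩ := hq x
      -- Completing the square.
      refine ⟨t / 2, ⟨n + t / 2 * (t / 2), ?_⟩, ?_⟩
      · have ht : t = 2 * (t / 2) := by field_simp
        generalize t / 2 = s at *
        subst ht
        simp only [mul_sub, sub_mul, smul_mul_assoc, mul_smul_comm, one_mul, mul_one, e]
        module
      · rintro ⟨k, hk⟩
        exact absurd ⟨k + t / 2, by rw [add_smul, ← hk, sub_add_cancel]⟩ hx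
  have uniq : ∀ (x : A) (s t : K), IsPure K (x - s • 1) → IsPure K (x - t • 1) → s = t := by
    intro x s t hs ht
    have e := hs.add h2 hq (ht.smul (-1))
    have e2 : x - s • 1 + (-1 : K) • (x - t • 1) = (t - s) • (1 : A) := by module
    rw [e2] at e
    have := e.2 ⟨_, rfl⟩
    rw [smul_eq_zero] at this
    exact (sub_eq_zero.mp (this.resolve_right one_ne_zero)).symm
  choose s hs using ex
  refine ⟨{ toFun := s, map_add' := ?_, map_smul' := ?_ }, ?_, ?_⟩
  · intro x y
    refine uniq _ _ _ (hs _) ?_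
    have := (hs x).add h2 hq (hs y)
    rwa [show x - s x • 1 + (y - s y • 1) = x + y - (s x + s y) • (1 : A) by module] at this
  · intro c x
    refine uniq _ _ _ (hs _) ?_
    have := (hs x).smul c
    rwa [show c • (x - s x • 1) = c • x - ((RingHom.id K) c • s x) • (1 : A) by
      rw [RingHom.id_apply, smul_eq_mul]; module] at this
  · refine uniq 1 _ _ (hs _) ?_
    rw [one_smul, sub_self]
    exact isPure_zero
  · intro u (hu : s u = 0)
    have := (hs u).1
    rwa [hu, zero_smul, sub_zero] at this

end QuadraticAlgebras

/-! ### Conjugation and norm -/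

/-- `s` is half the trace of a quadratic alternative division algebra (over a field of
characteristic not two). -/
structure IsScalarPart {K A : Type*} [Field K] [NonAssocRing A] [Module K A] [IsScalarTower K A A]
    [SMulCommClass K A A] (s : A →ₗ[K] K) : Prop where
  alt : IsAlternativeRing A
  dom : ∀ x y : A, x * y = 0 → x = 0 ∨ y = 0
  two : (2 : K) ≠ 0
  one : s 1 = 1
  sq : ∀ u, s u = 0 → ∃ k : K, u * u = k • 1
  comm : ∃ x y : A, x * y - y * x ≠ 0
  comm_sq : ∀ x y : A, ∃ k : K, (x * y - y * x) * (x * y - y * x) = k • 1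

namespace IsScalarPart

variable {K A : Type*} [Field K] [NonAssocRing A] [Module K A] [IsScalarTower K A A]
  [SMulCommClass K A A] {s : A →ₗ[K] K}

/-- The conjugation `x ↦ 2 s(x) - x`. -/
def conj (s : A →ₗ[K] K) : A →ₗ[K] A := (2 • s).smulRight 1 - LinearMap.id

omit [IsScalarTower K A A] [SMulCommClass K A A] in
theorem conj_apply (x : A) : conj s x = (2 * s x) • 1 - x := by
  simp [conj]

variable (h : IsScalarPart s)
include h

theorem nontrivial : Nontrivial A := by
  obtain ⟨x, y, e⟩ := h.comm
  exact ⟨_, _, e⟩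

theorem s_smul_one (k : K) : s (k • 1) = k := by
  rw [map_smul, h.one, smul_eq_mul, mul_one]

theorem s_conj (x : A) : s (conj s x) = s x := by
  rw [conj_apply, map_sub, h.s_smul_one]; ring

theorem conj_conj (x : A) : conj s (conj s x) = x := by
  rw [conj_apply (conj s x), h.s_conj, conj_apply, sub_sub_cancel]

theorem mul_self (x : A) : ∃ n : K, x * x = (2 * s x) • x - n • 1 := by
  obtain ⟨k, hk⟩ := h.sq (x - s x • 1) (by rw [map_sub, h.s_smul_one, sub_self])
  refine ⟨s x * s x - k, ?_⟩
  simp only [mul_sub, sub_mul, smul_mul_assoc, mul_smul_comm, one_mul, mul_one] at hk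
  linear_combination (norm := module) hk

theorem mul_conj (x : A) : x * conj s x = s (x * conj s x) • 1 := by
  obtain ⟨n, hn⟩ := h.mul_self x
  have : x * conj s x = n • 1 := by
    rw [conj_apply, mul_sub, hn, mul_smul_comm, mul_one]; module
  rw [this, h.s_smul_one]

theorem conj_mul (x : A) : conj s x * x = s (x * conj s x) • 1 := by
  rw [← h.mul_conj]
  simp only [conj_apply, mul_sub, sub_mul, smul_mul_assoc, mul_smul_comm, one_mul, mul_one]

/-- Let v = [x, y] and σ = s(v) ≠ 0. Since v² is scalar, the quadratic equation of v makes v scalar,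
v = σ. Then xv + vx = [x², y] = 2s(x)v shows that x is scalar, so v = 0. -/
theorem s_mul_comm (x y : A) : s (x * y) = s (y * x) := by
  have := h.nontrivial
  by_contra hne
  obtain ⟨k, hk⟩ := h.comm_sq x y
  obtain ⟨n, hn⟩ := h.mul_self (x * y - y * x)
  obtain ⟨m, hm⟩ := h.mul_self x
  have hσ : s (x * y - y * x) ≠ 0 := by rwa [map_sub, sub_ne_zero]
  have e1 : x * (x * y - y * x) + (x * y - y * x) * x = x * x * y - y * (x * x) := by
    obtain ⟨S, _, φ, x, y, -, rfl, rfl⟩ := h.alt.exists_associative_lift x y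
    simp only [← map_mul, ← map_sub, ← map_add]
    congr 1
    noncomm_ring
  rw [hm] at e1
  simp only [sub_mul (_ • x), mul_sub y, smul_mul_assoc, mul_smul_comm, one_mul, mul_one] at e1
  have e2 : (x * y - y * x) = (2 * s (x * y - y * x))⁻¹ • (k + n) • (1 : A) := by
    rw [eq_inv_smul_iff₀ (mul_ne_zero h.two hσ)]
    rw [hk] at hn
    linear_combination (norm := module) -hn
  rw [smul_smul] at e2
  have e3 : x * y - y * x = s (x * y - y * x) • 1 := by
    nth_rewrite 2 [e2]
    rw [h.s_smul_one, ← e2]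
  have e4 : (2 * s (x * y - y * x)) • x = (2 * s (x * y - y * x)) • (s x • (1 : A)) := by
    have e5 : (2 * s x) • (x * y) - (2 * s x) • (y * x) = (2 * s x) • (x * y - y * x) := by
      module
    rw [show (2 * s x) • (x * y) - m • y - ((2 * s x) • (y * x) - m • y)
      = (2 * s x) • (x * y - y * x) by module] at e1
    generalize s (x * y - y * x) = σ at *
    rw [e3, mul_smul_comm, smul_mul_assoc, mul_one, one_mul] at e1
    linear_combination (norm := module) e1
  have e5 := smul_right_injective A (mul_ne_zero h.two hσ) e4
  apply hσ
  rw [e5]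
  simp

theorem conj_mul_rev (x y : A) : conj s (x * y) = conj s y * conj s x := by
  obtain ⟨a, ha⟩ := h.mul_self x
  obtain ⟨b, hb⟩ := h.mul_self y
  obtain ⟨c, hc⟩ := h.mul_self (x + y)
  simp only [mul_add, add_mul, ha, hb, map_add] at hc
  have e1 : x * y + y * x = (2 * s x) • y + (2 * s y) • x - (c - a - b) • 1 := by
    linear_combination (norm := module) hc
  have e2 := congrArg s e1
  simp only [map_add, map_sub, map_smul, smul_eq_mul, h.one, mul_one] at e2
  rw [← h.s_mul_comm x y] at e2
  simp only [conj_apply, mul_sub, sub_mul, smul_mul_assoc, mul_smul_comm, one_mul, mul_one]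
  rw [show 2 * s (x * y) = 2 * s x * s y + 2 * s y * s x - (c - a - b) by
    linear_combination e2]
  linear_combination (norm := module) -e1

theorem eq_zero_of_norm_eq_zero {x : A} (e : s (x * conj s x) = 0) : x = 0 := by
  have e1 := h.mul_conj x
  rw [e, zero_smul] at e1
  rcases h.dom _ _ e1 with e2 | e2
  · exact e2
  · rw [← h.conj_conj x, e2, map_zero]

theorem conj_mul_mul (x y : A) : conj s x * (x * y) = s (x * conj s x) • y := by
  have e := (h.alt y x).2
  rw [associator, sub_eq_zero] at e
  have e1 : conj s x * (x * y) = conj s x * x * y := by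
    simp only [conj_apply, sub_mul, smul_mul_assoc, one_mul, e]
  rw [e1, h.conj_mul, smul_mul_assoc, one_mul]

theorem mul_mul_conj (x y : A) : x * y * conj s y = s (y * conj s y) • x := by
  have e := (h.alt x y).1
  rw [associator, sub_eq_zero] at e
  have e1 : x * y * conj s y = x * (y * conj s y) := by
    simp only [conj_apply, mul_sub, mul_smul_comm, mul_one, e]
  rw [e1, h.mul_conj, mul_smul_comm, mul_one, h.s_smul_one]

theorem norm_mul (x y : A) :
    s (x * y * conj s (x * y)) = s (x * conj s x) * s (y * conj s y) := by
  have e : associator (x * y) (conj s y) (conj s x) = 0 := by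
    have e1 : associator (x * y) y x = 0 := by
      rw [h.alt.swap_right, h.alt.bump_right, h.alt.self_outer, zero_mul, neg_zero]
    simp only [associator, conj_apply, mul_sub, sub_mul, smul_mul_assoc, mul_smul_comm, one_mul,
      mul_one, sub_eq_zero] at e1 ⊢
    rw [e1]
  rw [h.conj_mul_rev, ← sub_eq_zero.mp e, h.mul_mul_conj, smul_mul_assoc, map_smul, smul_eq_mul,
    mul_comm]

theorem bijective_mul {a : A} (ha : a ≠ 0) :
    Function.Bijective (fun x : A => a * x) ∧ Function.Bijective (fun x : A => x * a) := by
  have hn : s (a * conj s a) ≠ 0 := fun e => ha (h.eq_zero_of_norm_eq_zero e)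
  have hn' : s (conj s a * conj s (conj s a)) = s (a * conj s a) := by
    rw [h.conj_conj, h.s_mul_comm]
  refine ⟨⟨?_, fun y => ⟨(s (a * conj s a))⁻¹ • (conj s a * y), ?_⟩⟩,
    ⟨?_, fun y => ⟨(s (a * conj s a))⁻¹ • (y * conj s a), ?_⟩⟩⟩
  · intro x y (e : a * x = a * y)
    rw [← sub_eq_zero, ← mul_sub] at e
    exact sub_eq_zero.mp ((h.dom _ _ e).resolve_left ha)
  · have := h.conj_mul_mul (conj s a) y
    rw [hn', h.conj_conj] at this
    show a * _ = y
    rw [mul_smul_comm, this, inv_smul_smul₀ hn]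
  · intro x y (e : x * a = y * a)
    rw [← sub_eq_zero, ← sub_mul] at e
    exact sub_eq_zero.mp ((h.dom _ _ e).resolve_right ha)
  · have := h.mul_mul_conj y (conj s a)
    rw [hn', h.conj_conj] at this
    show _ * a = y
    rw [smul_mul_assoc, this, inv_smul_smul₀ hn]

/-- The norm form. -/
theorem exists_norm : ∃ N : QuadraticForm K A, (∀ x y : A, N (x * y) = N x * N y) ∧
    ∀ x : A, (∀ y : A, QuadraticMap.polar N x y = 0) → x = 0 := by
  let B : LinearMap.BilinMap K A K := ((LinearMap.mul K A).compl₂ (conj s)).compr₂ s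
  have hB : ∀ x, B.toQuadraticMap x = s (x * conj s x) := fun x => rfl
  refine ⟨B.toQuadraticMap, fun x y => ?_, fun x hx => ?_⟩
  · simp only [hB, h.norm_mul]
  · apply h.eq_zero_of_norm_eq_zero
    -- The polar form at (x, x) is twice the norm, and the norm is anisotropic.
    have e := hx x
    rw [QuadraticMap.polar_self, hB, nsmul_eq_mul, Nat.cast_ofNat] at e
    exact (mul_eq_zero.mp e).resolve_left h.two

end IsScalarPart

/-! ### Cayley–Dickson doubling and the dimension -/

namespace IsScalarPart

variable {K A : Type*} [Field K] [NonAssocRing A] [Module K A] [IsScalarTower K A A]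
  [SMulCommClass K A A] {s : A →ₗ[K] K}

/-- A unital subalgebra of `A`. -/
def IsSub (B : Submodule K A) : Prop := 1 ∈ B ∧ ∀ a ∈ B, ∀ b ∈ B, a * b ∈ B

/-- `l` is a non-zero element orthogonal to `B`. -/
def IsOrth (s : A →ₗ[K] K) (B : Submodule K A) (l : A) : Prop :=
  l ≠ 0 ∧ ∀ b ∈ B, s (b * conj s l) = 0

omit [IsScalarTower K A A] [SMulCommClass K A A] in
theorem IsSub.conj_mem {B : Submodule K A} (hB : IsSub B) {a : A} (ha : a ∈ B) :
    conj s a ∈ B := by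
  rw [conj_apply]
  exact sub_mem (B.smul_mem _ hB.1) ha

/-- The map `(a, b) ↦ a + b l`. -/
def doubling (B : Submodule K A) (l : A) : B × B →ₗ[K] A :=
  B.subtype.coprod ((LinearMap.mulRight K l).comp B.subtype)

omit [SMulCommClass K A A] in
theorem mem_doubling {B : Submodule K A} {l x : A} :
    x ∈ LinearMap.range (doubling B l) ↔ ∃ a ∈ B, ∃ b ∈ B, x = a + b * l := by
  constructor
  · rintro ⟨⟨⟨a, ha⟩, ⟨b, hb⟩⟩, rfl⟩
    exact ⟨a, ha, b, hb, rfl⟩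
  · rintro ⟨a, ha, b, hb, rfl⟩
    exact ⟨⟨⟨a, ha⟩, ⟨b, hb⟩⟩, rfl⟩

omit [SMulCommClass K A A] in
theorem isSub_span_one : IsSub (Submodule.span K {(1 : A)}) := by
  refine ⟨Submodule.mem_span_singleton_self 1, fun a ha b hb => ?_⟩
  obtain ⟨k, rfl⟩ := Submodule.mem_span_singleton.mp ha
  rw [smul_mul_assoc, one_mul]
  exact Submodule.smul_mem _ _ hb

variable (h : IsScalarPart s)
include h

/-- Anisotropy makes the pairing on B injective, hence onto the dual of B. So some b in B pairs with
B as x ∉ B does, and x - b is orthogonal to B. -/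
theorem exists_isOrth {B : Submodule K A} [FiniteDimensional K B] (hB : B ≠ ⊤) :
    ∃ l, IsOrth s B l := by
  obtain ⟨x, hx⟩ : ∃ x, x ∉ B := by
    by_contra! e
    exact hB (eq_top_iff.mpr fun x _ => e x)
  let F : A →ₗ[K] (B →ₗ[K] K) :=
    ((((LinearMap.mul K A).compl₂ (conj s)).compr₂ s).flip).compr₂ (LinearMap.id) |>.compl₂ B.subtype
  have hF : ∀ x b, F x b = s (b * conj s x) := fun x b => rfl
  have hinj : Function.Injective (F.comp B.subtype) := by
    rw [injective_iff_map_eq_zero]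
    intro b hb
    have := LinearMap.congr_fun hb b
    exact Subtype.ext (h.eq_zero_of_norm_eq_zero this)
  have hsurj : Function.Surjective (F.comp B.subtype) :=
    (LinearMap.injective_iff_surjective_of_finrank_eq_finrank
      (Subspace.dual_finrank_eq (K := K) (V := B)).symm).mp hinj
  obtain ⟨b, hb⟩ := hsurj (F x)
  refine ⟨x - b, fun e => hx ?_, fun c hc => ?_⟩
  · rw [sub_eq_zero.mp e]; exact b.2
  · have := LinearMap.congr_fun hb ⟨c, hc⟩
    rw [map_sub, mul_sub, map_sub, sub_eq_zero]
    exact this.symm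

section Formulas

variable {B : Submodule K A} (hB : IsSub B) {l : A} (hl : IsOrth s B l)
include hB hl

theorem s_orth : s l = 0 := by
  have := hl.2 1 hB.1
  rwa [one_mul, h.s_conj] at this

theorem conj_orth : conj s l = -l := by
  rw [conj_apply, h.s_orth hB hl, mul_zero, zero_smul, zero_sub]

theorem mul_orth {b : A} (hb : b ∈ B) : b * l = l * conj s b := by
  obtain ⟨n, e1⟩ : ∃ n : K, (b + l) * conj s (b + l) = n • 1 := ⟨_, h.mul_conj _⟩
  obtain ⟨n1, e2⟩ : ∃ n : K, b * conj s b = n • 1 := ⟨_, h.mul_conj _⟩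
  obtain ⟨n2, e3⟩ : ∃ n : K, l * conj s l = n • 1 := ⟨_, h.mul_conj _⟩
  have e4 := hl.2 b hb
  have e5 : s (l * conj s b) = 0 := by rw [← h.s_conj, h.conj_mul_rev, h.conj_conj, e4]
  rw [map_add, mul_add, add_mul, add_mul, e2, e3] at e1
  have e6 := congrArg s e1
  rw [map_add, map_add, map_add, e4, e5, h.s_smul_one, h.s_smul_one, h.s_smul_one] at e6
  rw [h.conj_orth hB hl, mul_neg, ← e6] at e1
  linear_combination (norm := module) -e1

theorem orth_sq : ∃ k : K, k ≠ 0 ∧ l * l = k • 1 := by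
  have e := h.mul_conj l
  have e0 : s (l * conj s l) ≠ 0 := fun e => hl.1 (h.eq_zero_of_norm_eq_zero e)
  refine ⟨-s (l * conj s l), neg_ne_zero.mpr e0, ?_⟩
  rw [neg_smul, ← e, h.conj_orth hB hl, mul_neg, neg_neg]

theorem orth_mul_add {b : A} (hb : b ∈ B) : l * b + b * l = (2 * s b) • l := by
  rw [h.mul_orth hB hl hb, ← mul_add, conj_apply, add_sub_cancel, mul_smul_comm, mul_one]

theorem mul_orth_mul {a : A} (ha : a ∈ B) (z : A) : a * (l * z) = l * (conj s a * z) := by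
  have e1 := h.alt.swap_left a l z
  have e2 := congrArg (· * z) (h.orth_mul_add hB hl ha)
  simp only [associator, add_mul, smul_mul_assoc] at e1 e2
  simp only [conj_apply, sub_mul, mul_sub, smul_mul_assoc, mul_smul_comm, one_mul]
  linear_combination (norm := module) e2 - e1

theorem mul_mul_orth {a b : A} (ha : a ∈ B) (hb : b ∈ B) : a * (b * l) = (b * a) * l := by
  rw [h.mul_orth hB hl hb, h.mul_orth_mul hB hl ha, ← h.conj_mul_rev, ← h.mul_orth hB hl (hB.2 b hb a ha)]

theorem orth_mul (z : A) {b : A} (hb : b ∈ B) : (z * l) * b = (z * conj s b) * l := by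
  have e1 := h.alt.swap_right z l b
  have e2 := congrArg (z * ·) (h.orth_mul_add hB hl hb)
  simp only [associator, mul_add, mul_smul_comm] at e1 e2
  simp only [conj_apply, sub_mul, mul_sub, smul_mul_assoc, mul_smul_comm, mul_one]
  linear_combination (norm := module) e2 + e1

theorem orth_mul_orth {a b : A} (ha : a ∈ B) (hb : b ∈ B) {k : K} (hk : l * l = k • 1) :
    (a * l) * (b * l) = k • (conj s b * a) := by
  have e := (h.alt (conj s b * a) l).2
  rw [associator, sub_eq_zero, hk, smul_mul_assoc, one_mul] at e
  rw [h.mul_orth hB hl ha, h.alt.middle_moufang,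
    h.mul_orth hB hl (hB.2 _ (hB.conj_mem ha) _ hb), h.conj_mul_rev, h.conj_conj, e]

omit hB in
theorem mul_orth_cancel {a : A} (e : a * l = 0) : a = 0 :=
  (h.dom _ _ e).resolve_right hl.1

/-- Evaluating (b, al, c) = -(b, c, al) by the doubling formulas leaves an associator of B times l,
and l can be cancelled. A subalgebra that can be doubled is therefore associative. -/
theorem associator_eq_zero_of_orth {a b c : A} (ha : a ∈ B) (hb : b ∈ B) (hc : c ∈ B) :
    associator a b c = 0 := by
  apply h.mul_orth_cancel hl
  have e := h.alt.swap_right b (a * l) c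
  simp only [associator] at e ⊢
  rw [h.mul_mul_orth hB hl hb ha, h.orth_mul hB hl _ hc, h.orth_mul hB hl _ hc,
    h.mul_mul_orth hB hl hb (hB.2 _ ha _ (hB.conj_mem hc)),
    h.mul_mul_orth hB hl (hB.2 _ hb _ hc) ha, h.mul_mul_orth hB hl hc ha,
    h.mul_mul_orth hB hl hb (hB.2 _ ha _ hc)] at e
  simp only [conj_apply, sub_mul, mul_sub, smul_mul_assoc, mul_smul_comm, mul_one] at e ⊢
  linear_combination (norm := module) -e

theorem isSub_doubling : IsSub (LinearMap.range (doubling B l)) := by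
  obtain ⟨k, -, hk⟩ := h.orth_sq hB hl
  refine ⟨mem_doubling.mpr ⟨1, hB.1, 0, B.zero_mem, by simp⟩, ?_⟩
  intro x hx y hy
  obtain ⟨a, ha, b, hb, rfl⟩ := mem_doubling.mp hx
  obtain ⟨c, hc, d, hd, rfl⟩ := mem_doubling.mp hy
  refine mem_doubling.mpr ⟨a * c + k • (conj s d * b),
    add_mem (hB.2 _ ha _ hc) (B.smul_mem _ (hB.2 _ (hB.conj_mem hd) _ hb)),
    d * a + b * conj s c, add_mem (hB.2 _ hd _ ha) (hB.2 _ hb _ (hB.conj_mem hc)), ?_⟩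
  rw [add_mul, mul_add, mul_add, h.mul_mul_orth hB hl ha hd, h.orth_mul hB hl b hc,
    h.orth_mul_orth hB hl hb hd hk, add_mul]
  abel

/-- If a + bl = 0 with b ≠ 0, multiplying by the conjugate of b puts l in B; then l is orthogonal to
itself, against anisotropy. -/
theorem doubling_injective : Function.Injective (doubling B l) := by
  rw [injective_iff_map_eq_zero]
  rintro ⟨⟨a, ha⟩, ⟨b, hb⟩⟩ (e : a + b * l = 0)
  have hb0 : b = 0 := by
    by_contra hb0
    have hn : s (b * conj s b) ≠ 0 := fun e => hb0 (h.eq_zero_of_norm_eq_zero e)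
    have e1 := h.conj_mul_mul b l
    rw [eq_neg_of_add_eq_zero_right e] at e1
    have hlB : l ∈ B := by
      rw [← inv_smul_smul₀ hn l, ← e1]
      exact B.smul_mem _ (hB.2 _ (hB.conj_mem hb) _ (neg_mem ha))
    exact hl.1 (h.eq_zero_of_norm_eq_zero (hl.2 l hlB))
  subst hb0
  rw [zero_mul, add_zero] at e
  subst e
  rfl

theorem finrank_doubling [FiniteDimensional K B] :
    Module.finrank K (LinearMap.range (doubling B l)) = 2 * Module.finrank K B := by
  rw [LinearMap.finrank_range_of_inj (h.doubling_injective hB hl), Module.finrank_prod, two_mul]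

end Formulas

theorem finrank_eq_eight (hnonassoc : ¬ IsAssociativeRing A) : Module.finrank K A = 8 := by
  have := h.nontrivial
  obtain ⟨p, q, hpq⟩ := h.comm
  have hB0 := isSub_span_one (K := K) (A := A)
  set B0 := Submodule.span K {(1 : A)} with hB0d
  have hB0top : B0 ≠ ⊤ := by
    intro e
    apply hpq
    have hp : p ∈ B0 := by rw [e]; trivial
    obtain ⟨k, rfl⟩ := Submodule.mem_span_singleton.mp hp
    simp
  obtain ⟨i, hi⟩ := h.exists_isOrth hB0top
  have hB1 := h.isSub_doubling hB0 hi
  have hB1mem : ∀ x, x ∈ LinearMap.range (doubling B0 i) → ∃ a b : K, x = a • 1 + b • i := by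
    intro x hx
    obtain ⟨a, ha, b, hb, rfl⟩ := mem_doubling.mp hx
    obtain ⟨a, rfl⟩ := Submodule.mem_span_singleton.mp ha
    obtain ⟨b, rfl⟩ := Submodule.mem_span_singleton.mp hb
    exact ⟨a, b, by simp⟩
  have hiB1 : i ∈ LinearMap.range (doubling B0 i) :=
    mem_doubling.mpr ⟨0, B0.zero_mem, 1, hB0.1, by simp⟩
  have d1 := h.finrank_doubling hB0 hi
  set B1 := LinearMap.range (doubling B0 i)
  have hB1top : B1 ≠ ⊤ := by
    intro e
    apply hpq
    obtain ⟨a, b, rfl⟩ := hB1mem p (by rw [e]; trivial)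
    obtain ⟨c, d, rfl⟩ := hB1mem q (by rw [e]; trivial)
    simp only [add_mul, mul_add, smul_mul_assoc, mul_smul_comm, one_mul, mul_one]
    module
  obtain ⟨j, hj⟩ := h.exists_isOrth hB1top
  have hB2 := h.isSub_doubling hB1 hj
  have hiB2 : i ∈ LinearMap.range (doubling B1 j) :=
    mem_doubling.mpr ⟨i, hiB1, 0, B1.zero_mem, by simp⟩
  have hjB2 : j ∈ LinearMap.range (doubling B1 j) :=
    mem_doubling.mpr ⟨0, B1.zero_mem, 1, hB1.1, by simp⟩
  have d2 := h.finrank_doubling hB1 hj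
  have hB2mem : ∀ x, x ∈ LinearMap.range (doubling B1 j) →
      ∃ a b c d : K, x = a • 1 + b • i + c • j + d • (i * j) := by
    intro x hx
    obtain ⟨a, ha, b, hb, rfl⟩ := mem_doubling.mp hx
    obtain ⟨a, b, rfl⟩ := hB1mem a ha
    obtain ⟨c, d, rfl⟩ := hB1mem _ hb
    exact ⟨a, b, c, d, by simp [add_mul, add_assoc, smul_mul_assoc]⟩
  set B2 := LinearMap.range (doubling B1 j)
  have hB2top : B2 ≠ ⊤ := by
    intro e
    apply hnonassoc
    -- If `B2` were everything, 1, i, j, ij would span A. The last three lie in an associative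
    -- subring, which need not contain 1, so 1 is treated separately.
    obtain ⟨S, hiS, hjS, hS⟩ := h.alt.artin i j
    have key : ∀ f : A →ₗ[K] A, f 1 = 0 → (∀ x ∈ S, f x = 0) → ∀ x, f x = 0 := by
      intro f f1 fS x
      obtain ⟨a, b, c, d, rfl⟩ := hB2mem x (by rw [e]; trivial)
      simp only [map_add, map_smul, f1, fS i hiS, fS j hjS, fS _ (S.mul_mem hiS hjS), smul_zero,
        add_zero]
    have k1 : ∀ x ∈ S, ∀ y ∈ S, ∀ z, associator x y z = 0 := by
      intro x hx y hy
      exact key (LinearMap.mulLeft K (x * y) - (LinearMap.mulLeft K x).comp (LinearMap.mulLeft K y))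
        (by simp) (fun z hz => hS x hx y hy z hz)
    have k2 : ∀ x ∈ S, ∀ y z, associator x y z = 0 := by
      intro x hx y z
      rw [h.alt.swap_right, neg_eq_zero]
      revert y
      refine key ((LinearMap.mulLeft K (x * z)) - (LinearMap.mulLeft K x).comp
        (LinearMap.mulLeft K z)) (by simp) (fun y hy => ?_)
      show associator x z y = 0
      rw [h.alt.swap_right, k1 x hx y hy, neg_zero]
    intro x y z
    rw [h.alt.cyc]
    revert x
    refine key ((LinearMap.mulLeft K (y * z)) - (LinearMap.mulLeft K y).comp
        (LinearMap.mulLeft K z)) (by simp) (fun x hx => ?_)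
    show associator y z x = 0
    rw [← h.alt.cyc, k2 x hx]
  obtain ⟨l, hl⟩ := h.exists_isOrth hB2top
  have hB3 := h.isSub_doubling hB2 hl
  have d3 := h.finrank_doubling hB2 hl
  have hB3top : LinearMap.range (doubling B2 l) = ⊤ := by
    by_contra hne
    obtain ⟨m, hm⟩ := h.exists_isOrth hne
    -- A further doubling would give 0 = (i, j, l) = (ij - ji)l, so ij = ji; but ij = -ji by
    -- orthogonality, and 2ji = 0 is impossible.
    have e := h.associator_eq_zero_of_orth hB3 hm
      (a := i) (b := j) (c := l) (mem_doubling.mpr ⟨i, hiB2, 0, B2.zero_mem, by simp⟩)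
      (mem_doubling.mpr ⟨j, hjB2, 0, B2.zero_mem, by simp⟩)
      (mem_doubling.mpr ⟨0, B2.zero_mem, 1, hB2.1, by simp⟩)
    rw [associator, h.mul_mul_orth hB2 hl hiB2 hjB2, ← sub_mul] at e
    have e1 := h.mul_orth_cancel hl e
    rw [h.mul_orth hB1 hj hiB1, h.conj_orth hB0 hi, mul_neg, ← neg_add', neg_eq_zero,
      ← two_smul K, smul_eq_zero_iff_right h.two] at e1
    rcases h.dom _ _ e1 with e | e
    · exact hj.1 e
    · exact hi.1 e
  rw [hB3top, finrank_top, d2, d1, hB0d, finrank_span_singleton one_ne_zero] at d3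
  exact d3

end IsScalarPart

/-! ### Transfer to the central quotient -/

namespace CentralQuotient

variable {R : Type*} [NonUnitalNonAssocRing R] [HasCentralQuotient R]

theorem mk_eq_zero_iff {a : R} {c : Den R} : mk a c = 0 ↔ a = 0 := by
  rw [zero_def, mk_eq_mk, act_zero]
  exact ⟨fun e => act_injective _ (e.trans (act_zero _).symm), fun e => by rw [e, act_zero]⟩

theorem mk_sub_mk (a b : R) (c : Den R) : mk a c - mk b c = mk (a - b) c := by
  rw [sub_eq_add_neg, neg_mk, mk_add_mk, mk_eq_mk, den_mul, act_mul, ← act_add, ← sub_eq_add_neg]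

theorem mk_mul_sub_mk_mul (a b : R) (c d : Den R) :
    mk a c * mk b d - mk b d * mk a c = mk (a * b - b * a) (c * d) := by
  rw [← mk_sub_mk, mk_mul_mk, mk_mul_mk, sub_right_inj, mk_eq_mk, den_mul, den_mul, act_mul,
    act_mul, act_comm]

theorem associator_mk (a b e : R) (c d f : Den R) :
    associator (mk a c) (mk b d) (mk e f) = mk (associator a b e) (c * d * f) := by
  rw [associator, associator, ← mk_sub_mk, mk_mul_mk, mk_mul_mk, mk_mul_mk, mk_mul_mk,
    sub_right_inj, mk_eq_mk]
  simp only [den_mul, act_mul]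

theorem exists_smul_one_of_mem_center {z : R} (hz : z ∈ NonUnitalSubring.center R) (e : Den R) :
    ∃ k : CenterFractionField R, mk z e = k • 1 := by
  refine ⟨mk ⟨z, hz⟩ (toDen e.1 e.2), ?_⟩
  rw [one_def, mk_smul_mk, mk_eq_mk, den_mul, act_mul]
  congr 1
  exact ((hz.comm _).symm : _ * z = z * _)

theorem isAlternativeRing (h : IsAlternativeRing R) : IsAlternativeRing (CentralQuotient R) := by
  intro x y
  induction x using ind with | _ a c
  induction y using ind with | _ b d
  simp only [associator_mk, (h a b).1, (h a b).2, mk_eq_zero_iff, and_self]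

theorem not_isAssociativeRing (hR : ¬ IsAssociativeRing R) :
    ¬ IsAssociativeRing (CentralQuotient R) := by
  intro e
  apply hR
  intro x y z
  let c := Classical.arbitrary (Den R)
  have := e (mk x c) (mk y c) (mk z c)
  rwa [associator_mk, mk_eq_zero_iff] at this

theorem mul_eq_zero (hd : ∀ x y : R, x * y = 0 → x = 0 ∨ y = 0) (x y : CentralQuotient R)
    (e : x * y = 0) : x = 0 ∨ y = 0 := by
  induction x using ind with | _ a c
  induction y using ind with | _ b d
  rw [mk_mul_mk, mk_eq_zero_iff] at e
  rw [mk_eq_zero_iff, mk_eq_zero_iff]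
  exact hd a b e

theorem two_ne_zero (h2 : ∃ x : R, 2 • x ≠ 0) : (2 : CenterFractionField R) ≠ 0 := by
  obtain ⟨x, hx⟩ := h2
  intro e
  apply hx
  have e1 := two_smul (CenterFractionField R) (mk x (Classical.arbitrary (Den R)))
  rw [e, zero_smul, mk_add_mk, eq_comm, mk_eq_zero_iff, ← act_add, ← act_zero
    (Classical.arbitrary (Den R)).1] at e1
  rw [two_nsmul]
  exact act_injective _ e1

theorem commutator_sq (hR : ∀ x y : R,
    (x * y - y * x) * (x * y - y * x) ∈ NonUnitalSubring.center R) (x y : CentralQuotient R) :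
    ∃ k : CenterFractionField R, (x * y - y * x) * (x * y - y * x) = k • 1 := by
  induction x using ind with | _ a c
  induction y using ind with | _ b d
  rw [mk_mul_sub_mk_mul, mk_mul_mk]
  exact exists_smul_one_of_mem_center (hR a b) _

theorem exists_commutator_ne_zero (hR : ∃ x y : R, x * y - y * x ≠ 0) :
    ∃ x y : CentralQuotient R, x * y - y * x ≠ 0 := by
  obtain ⟨x, y, hxy⟩ := hR
  refine ⟨mk x (Classical.arbitrary _), mk y (Classical.arbitrary _), ?_⟩
  rwa [mk_mul_sub_mk_mul, Ne, mk_eq_zero_iff]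

theorem mem_center_of_mk_mem_center {a : R} {c : Den R}
    (e : mk a c ∈ NonUnitalSubring.center (CentralQuotient R)) :
    a ∈ NonUnitalSubring.center R := by
  have as : ∀ x y z : R, associator (mk x c) (mk y c) (mk z c) = 0 → x * (y * z) = x * y * z := by
    intro x y z e
    rw [associator_mk, mk_eq_zero_iff] at e
    exact (sub_eq_zero.mp e).symm
  refine ⟨fun x => ?_, fun x y => as _ _ _ ?_, fun x y => (as _ _ _ ?_).symm⟩
  · have := sub_eq_zero.mpr (e.comm (mk x c)).eq
    rw [mk_mul_sub_mk_mul, mk_eq_zero_iff] at this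
    exact sub_eq_zero.mp this
  · exact sub_eq_zero.mpr (e.left_assoc _ _).symm
  · exact sub_eq_zero.mpr (e.right_assoc _ _)

theorem center_eq_range : (NonUnitalSubring.center (CentralQuotient R) : Set (CentralQuotient R)) =
    Set.range (fun k : CenterFractionField R => k • (1 : CentralQuotient R)) := by
  ext q
  constructor
  · intro e
    induction q using ind with | _ a c
    obtain ⟨k, hk⟩ := exists_smul_one_of_mem_center (mem_center_of_mk_mem_center e) c
    exact ⟨k, hk.symm⟩
  · rintro ⟨k, rfl⟩
    refine ⟨fun x => ?_, fun x y => ?_, fun x y => ?_⟩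
    · show k • 1 * x = x * k • 1
      rw [smul_mul_assoc, mul_smul_comm, one_mul, mul_one]
    · simp only [smul_mul_assoc, one_mul]
    · simp only [mul_smul_comm, mul_one]

end CentralQuotient

/-! ### The main theorem -/

theorem theorem1p3 (R : Type*) [NonUnitalNonAssocRing R]
    (halt : IsAlternativeRing R) (hnonassoc : ¬ IsAssociativeRing R)
    (hH : HypH1 R ∨ HypH2 R ∨ HypH3 R) (hT : HypT1 R ∨ HypT2 R) :
    (∀ x y : R, x * y = 0 → x = 0 ∨ y = 0) ∧
    ((∃ x : R, 2 • x ≠ 0) →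
      ∃ _ : HasCentralQuotient R,
        IsOctonionAlgebra (CenterFractionField R) (CentralQuotient R) ∧
        IsDivisionAlgebra (CentralQuotient R) ∧
        (NonUnitalSubring.center (CentralQuotient R) : Set (CentralQuotient R)) =
          Set.range (fun k : CenterFractionField R => k • (1 : CentralQuotient R))) := by
  have hne := halt.exists_mul_ne_mul hnonassoc hT
  have hd : ∀ x y : R, x * y = 0 → x = 0 ∨ y = 0 := fun _ _ =>
    halt.eq_zero_or_eq_zero_of_mul_eq_zero (halt.commutatorsRegular hH) hT hne
  refine ⟨hd, fun h2 => ?_⟩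
  have hsq := halt.commutator_sq_mem_center hd hnonassoc
  have hC : HasCentralQuotient R := by
    refine ⟨?_, fun c hc a e => (hd _ _ e).resolve_left fun e => hc (Subtype.ext e)⟩
    obtain ⟨x, y, hxy⟩ := hne
    -- The square of a non-zero commutator is a non-zero central element.
    refine ⟨⟨_, hsq x y⟩, fun e => hxy ?_⟩
    rcases hd _ _ (congrArg Subtype.val e) with e | e <;> exact e
  have alt := CentralQuotient.isAlternativeRing halt
  have dom := CentralQuotient.mul_eq_zero hd
  have two := CentralQuotient.two_ne_zero h2
  have csq := CentralQuotient.commutator_sq hsq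
  have comm := CentralQuotient.exists_commutator_ne_zero hne
  have hnt : Nontrivial (CentralQuotient R) := by
    obtain ⟨x, y, e⟩ := comm
    exact ⟨_, _, e⟩
  obtain ⟨s, s1, ssq⟩ := exists_scalar_part two (alt.exists_quadratic dom two csq comm)
  have h : IsScalarPart s := ⟨alt, dom, two, s1, ssq, comm, csq⟩
  exact ⟨hC, ⟨h.finrank_eq_eight (CentralQuotient.not_isAssociativeRing hnonassoc),
    h.exists_norm⟩, ⟨hnt, fun a ha => h.bijective_mul ha⟩, CentralQuotient.center_eq_range⟩
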